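/- Let $\Sigma$ be a finite totally ordered alphabet, $\Sigma^*=\bigcup_{k\ge 0}\Sigma^k$, and let $\mu$ be a probability measure on the infinite words $\Sigma^{\infty}$ (a probabilistic source). For $w\in\Sigma^k$ let $p_w$ be the $\mu$-probability that a word has prefix $w$, and assume $$\sum_{k=0}^{\infty}\Big(\sum_{w\in\Sigma^k}p_w^2\Big)^{1/2}<\infty .$$ Keys that are independent with common distribution $\mu$ are generated at the arrival times of a unit-rate Poisson process $N=(N(t))_{t\ge 0}$ that is independent of the keys. The first $n$ keys are sorted in lexicographic order by QuickSort: the first key of the list is the pivot, every other key is compared with it, and the keys smaller than the pivot and the remaining keys, each in order of arrival, are sorted recursively. Two keys are compared by scanning the two words from left to right, comparing symbols of matching index until a difference is found. For the sorting of the $N(t)$ keys generated through epoch $t$ let $K(t)$ be the number of key comparisons, $S(t)$ the total number of symbol comparisons, $S_k(t)$ the number of comparisons of $(k+1)$st symbols, and $S_w(t)$, for $w\in\Sigma^k$, the number of comparisons of $(k+1)$st symbols between keys with prefix $w$. For $t>0$ put $Y(t)=(S(t)-\mathbf{E}S(t))/t$ and $Y_k(t)=(S_k(t)-\mathbf{E}S_k(t))/t$.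 **Proposition.** Suppose that for each fixed $t>0$ the random variables $S_w(t)$, $w\in\Sigma^*$, are nonnegatively correlated, i.e. $\mathbf{Cov}(S_v(t),S_w(t))\ge 0$ for all $v,w\in\Sigma^*$. Then: 1. For every $t>0$, $S(t)$ is almost surely finite, $S(t)$ and $K(t)$ are square integrable, and $$\mathbf{Var}\,Y(t)\ \ge\ \mathbf{Var}\,Y_0(t)\ =\ t^{-2}\,\mathbf{Var}\,K(t).$$ 2. With $\sigma^2:=7-\tfrac23\pi^2>0$ we have $\mathbf{Var}\,Y(t)\ge\sigma^2-o(1)$ as $t\to\infty$. 3. The limit $Y$ of $Y(t)$ in $L^2$ as $t\to\infty$ is nondegenerate: if $Y$ is a random variable with $Y(t)\to Y$ in $L^2$, then $Y$ is square integrable, $\mathbf{Var}\,Y\ge\sigma^2>0$, and $Y$ is not almost surely equal to a constant. -/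

import Mathlib

open MeasureTheory ProbabilityTheory Filter Topology
open scoped NNReal ENNReal

namespace QuickSortSymbols

/-- The key comparisons performed by QuickSort on a list, in the order in which they are made.
The first element `p` of the list is the pivot; it is compared with each of the other elements,
and then the sublist of the elements smaller than `p` and the sublist of the remaining elements,
both in their original order, are sorted recursively. -/
def keyComparisons {β : Type*} [LinearOrder β] : List β → List (β × β)
  | [] => []
  | p :: l =>
      l.map (fun x => (x, p))
        ++ (keyComparisons (l.filter (fun x => x < p))
        ++ keyComparisons (l.filter (fun x => ¬ x < p)))
termination_by l => l.length
decreasing_by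
  all_goals
    simp only [List.length_cons, List.length_unattach]
    exact Nat.lt_succ_of_le ((List.length_filter_le _ _).trans (by simp))

section Counts

variable {α : Type*} [LinearOrder α]

/-- Two words `u`, `v` are compared by scanning from left to right until a difference is found.
Hence their `(k+1)`st symbols (those of index `k`) are compared iff the first `k` symbols agree. -/
def ComparesSymbol (k : ℕ) (u v : ℕ → α) : Prop := ∀ i < k, u i = v i

instance (k : ℕ) (u v : ℕ → α) : Decidable (ComparesSymbol k u v) :=
  inferInstanceAs (Decidable (∀ i < k, u i = v i))

/-- The infinite word `u` has the finite word `w = w₁ ⋯ w_k` as its prefix of length `k`. -/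
def HasPrefix {k : ℕ} (w : Fin k → α) (u : ℕ → α) : Prop := ∀ i : Fin k, u i = w i

instance {k : ℕ} (w : Fin k → α) (u : ℕ → α) : Decidable (HasPrefix w u) :=
  inferInstanceAs (Decidable (∀ i : Fin k, u i = w i))

/-- The number of symbol comparisons made in comparing the words `u` and `v`; it is infinite if
the words are equal, since then no difference is ever found. -/
noncomputable def symbolCost (u v : ℕ → α) : ℕ∞ := {k : ℕ | ComparesSymbol k u v}.encard

/-- The key comparisons made when the first `n` of the words `x 0, x 1, …` are sorted by QuickSort
in the lexicographic order. -/
noncomputable def comparisons (x : ℕ → ℕ → α) (n : ℕ) : List ((ℕ → α) × (ℕ → α)) :=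
  (keyComparisons ((List.range n).map (fun i => toLex (x i)))).map
    (fun uv => (ofLex uv.1, ofLex uv.2))

/-- `K_n`, the number of key comparisons. -/
noncomputable def keyCount (x : ℕ → ℕ → α) (n : ℕ) : ℕ := (comparisons x n).length

/-- `S_n`, the total number of symbol comparisons. -/
noncomputable def symbolCount (x : ℕ → ℕ → α) (n : ℕ) : ℕ∞ :=
  ((comparisons x n).map (fun uv => symbolCost uv.1 uv.2)).sum

/-- The number of comparisons of `(k+1)`st symbols. -/
noncomputable def levelCount (k : ℕ) (x : ℕ → ℕ → α) (n : ℕ) : ℕ :=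
  (comparisons x n).countP (fun uv => ComparesSymbol k uv.1 uv.2)

/-- The number of comparisons of `(k+1)`st symbols between keys with the prefix `w` of
length `k`. -/
noncomputable def prefixCount {k : ℕ} (w : Fin k → α) (x : ℕ → ℕ → α) (n : ℕ) : ℕ :=
  (comparisons x n).countP
    (fun uv => ComparesSymbol k uv.1 uv.2 ∧ HasPrefix w uv.1 ∧ HasPrefix w uv.2)

/-- The fundamental probability `p_w` of the source `μ`. -/
noncomputable def prefixProb [MeasurableSpace α] (μ : Measure (ℕ → α)) {k : ℕ} (w : Fin k → α) :
    ℝ := μ.real {u | HasPrefix w u}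

end Counts

section Processes

variable {Ω : Type*} [MeasurableSpace Ω]

/-- `N` is a Poisson process with unit rate on `[0, ∞)`: a counting process started at `0`, with
nondecreasing right-continuous paths and independent increments, such that `N t - N s` has the
Poisson distribution with parameter `t - s` whenever `s ≤ t`. -/
structure IsUnitPoissonProcess (N : ℝ≥0 → Ω → ℕ) (P : Measure Ω) : Prop where
  measurable : ∀ t, Measurable (N t)
  start : ∀ᵐ ω ∂P, N 0 ω = 0
  monotone : ∀ᵐ ω ∂P, Monotone (fun t => N t ω)
  rightCont : ∀ᵐ ω ∂P, ∀ t, ContinuousWithinAt (fun s => N s ω) (Set.Ici t) t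
  indepIncrements : HasIndepIncrements N P
  incrementLaw : ∀ s t, s ≤ t → HasLaw (fun ω => N t ω - N s ω) (poissonMeasure (t - s)) P

variable {α : Type*} [MeasurableSpace α]

/-- The keys `X 0, X 1, …` are independent with common distribution `μ`, the process `N` counting
the arrivals of the keys is a Poisson process with unit rate, and it is independent of the keys. -/
structure IsPoissonKeyModel (μ : Measure (ℕ → α)) (X : ℕ → Ω → ℕ → α) (N : ℝ≥0 → Ω → ℕ)
    (P : Measure Ω) : Prop where
  measurable : ∀ i, Measurable (X i)
  keyLaw : ∀ i, HasLaw (X i) μ P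
  indep : iIndepFun X P
  poisson : IsUnitPoissonProcess N P
  indepArrivals : IndepFun (fun ω i => X i ω) (fun ω t => N t ω) P

variable [LinearOrder α]

/-- `K(t) = K_{N(t)}`. -/
noncomputable def keyCountAt (X : ℕ → Ω → ℕ → α) (N : ℝ≥0 → Ω → ℕ) (t : ℝ≥0) (ω : Ω) : ℝ :=
  keyCount (fun i => X i ω) (N t ω)

/-- `S(t) = S_{N(t)}` with values in `ℕ ∪ {∞}`. -/
noncomputable def symbolCountAt (X : ℕ → Ω → ℕ → α) (N : ℝ≥0 → Ω → ℕ) (t : ℝ≥0) (ω : Ω) : ℕ∞ :=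
  symbolCount (fun i => X i ω) (N t ω)

/-- `S(t)` as a real random variable (it agrees with the former wherever that is finite). -/
noncomputable def realSymbolCountAt (X : ℕ → Ω → ℕ → α) (N : ℝ≥0 → Ω → ℕ) (t : ℝ≥0) (ω : Ω) : ℝ :=
  ((symbolCountAt X N t ω).toNat : ℝ)

/-- `S_k(t)`. -/
noncomputable def levelCountAt (X : ℕ → Ω → ℕ → α) (N : ℝ≥0 → Ω → ℕ) (k : ℕ) (t : ℝ≥0) (ω : Ω) :
    ℝ := levelCount k (fun i => X i ω) (N t ω)

/-- `S_w(t)`. -/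
noncomputable def prefixCountAt (X : ℕ → Ω → ℕ → α) (N : ℝ≥0 → Ω → ℕ) {k : ℕ} (w : Fin k → α)
    (t : ℝ≥0) (ω : Ω) : ℝ := prefixCount w (fun i => X i ω) (N t ω)

/-- `Y(t) = (S(t) - E S(t)) / t`. -/
noncomputable def scaledSymbolCount (X : ℕ → Ω → ℕ → α) (N : ℝ≥0 → Ω → ℕ) (P : Measure Ω)
    (t : ℝ≥0) (ω : Ω) : ℝ :=
  (realSymbolCountAt X N t ω - ∫ ω', realSymbolCountAt X N t ω' ∂P) / t

/-- `Y_k(t) = (S_k(t) - E S_k(t)) / t`. -/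
noncomputable def scaledLevelCount (X : ℕ → Ω → ℕ → α) (N : ℝ≥0 → Ω → ℕ) (P : Measure Ω)
    (k : ℕ) (t : ℝ≥0) (ω : Ω) : ℝ :=
  (levelCountAt X N k t ω - ∫ ω', levelCountAt X N k t ω' ∂P) / t

end Processes

end QuickSortSymbols

open QuickSortSymbols

set_option linter.unusedSectionVars false

namespace QuickSortSymbols

/-! ### Deterministic bounds on the list of key comparisons -/

section Combinatorics

variable {β : Type*} [LinearOrder β]

/-! Write `S(t)` as the sum of `S_k(t)` over the levels `k`, where `S_0(t) = K(t)` because every key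
comparison looks at the first symbols. Each `S_k(t)` is the finite sum of the `S_w(t)` with `w` of
length `k`, so the levels inherit nonnegative correlation. Hence for a partial sum `S_0 + R` one has
`Var (S_0 + R) = Var S_0 + 2 Cov(S_0, R) + Var R ≥ Var S_0`.

The passage to the full sum needs `S(t)` in `L²`. If `S_k` is nonzero for `n` keys, then some pair
of them agrees in `k` symbols. A union bound with `S_k ≤ n²` and the sixth Poisson moment gives
`‖S_k(t)‖₂ ≤ C √(∑ p_w²)` with `C` independent of `k` (`exists_eLpNorm_levelCountAt_le`), which is
summable by assumption. Minkowski's inequality and monotone convergence give square integrability,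
and dominated convergence carries the variance inequality over (`variance_levelCountAt_zero_le`).

It remains to bound `Var K(t)` from below. Summability forces `∑ p_w² → 0`, so the keys are almost
surely distinct, and by exchangeability the law of `K_n` may be averaged over all orderings.
Splitting by the rank of the pivot gives the classical recursions for the first two moments
(`permAvg_moments`), which are solved in closed form with harmonic numbers. The resulting variance
is at least `(σ² - ε) n² - C` for each `ε > 0` (`exists_varKey_ge`). Conditioning on `N(t)` and
using `E N(t)² ≥ t²` yields `Var K(t) ≥ (σ² - ε) t² - C` as long as `σ² - ε ≥ 0`.

Finally, asymptotic lower bounds on variances survive `L²` limits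
(`le_variance_of_tendsto_eLpNorm`), and `π < 3.15` gives `σ² > 0`; a constant limit would have
variance zero. -/

theorem length_filter_add_length_filter_not {γ : Type*} (p : γ → Bool) (l : List γ) :
    (l.filter p).length + (l.filter (fun x => !p x)).length = l.length := by
  induction l with
  | nil => simp
  | cons a l ih => by_cases h : p a <;> simp [h] <;> omega

theorem length_keyComparisons_le (n : ℕ) :
    ∀ l : List β, l.length = n → (keyComparisons l).length ≤ n ^ 2 := by
  induction n using Nat.strong_induction_on with
  | _ n ih =>
    intro l hl
    cases l with
    | nil => simp [keyComparisons]
    | cons p l =>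
      rw [keyComparisons]
      simp only [List.length_cons] at hl
      have hs := length_filter_add_length_filter_not (fun x => decide (x < p)) l
      have h1 := ih _ (by omega) (l.filter (fun x => decide (x < p))) rfl
      have h2 := ih _ (by omega) (l.filter (fun x => !decide (x < p))) rfl
      simp only [List.length_append, List.length_map, decide_not]
      subst hl
      nlinarith

/-- Every comparison is recorded as (later key, pivot), and filtering preserves the order of
arrival. So it suffices that `q` fails on pairs whose second entry comes earlier in the list. -/
theorem countP_keyComparisons_eq_zero (q : β × β → Bool) (n : ℕ) :
    ∀ l : List β, l.length = n → l.Pairwise (fun u v => q (v, u) = false) →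
      (keyComparisons l).countP q = 0 := by
  induction n using Nat.strong_induction_on with
  | _ n ih =>
    intro l hl hq
    cases l with
    | nil => simp [keyComparisons]
    | cons p l =>
      rw [keyComparisons]
      simp only [List.length_cons] at hl
      have hs := length_filter_add_length_filter_not (fun x => decide (x < p)) l
      rw [List.pairwise_cons] at hq
      have h1 := ih _ (by omega) (l.filter (fun x => decide (x < p))) rfl (hq.2.filter _)
      have h2 := ih _ (by omega) (l.filter (fun x => !decide (x < p))) rfl (hq.2.filter _)
      rw [List.countP_append, List.countP_append]
      simp only [decide_not, h1, h2, add_zero, List.countP_map]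
      rw [List.countP_eq_zero]
      intro a ha
      simp [hq.1 a ha]

end Combinatorics

/-! ### Averages over random orderings -/

section PermAvg

variable {ι : Type*} [DecidableEq ι]

/-- The average of `G` over all orderings of a finite set `s` with `n` elements. -/
noncomputable def permAvg : ℕ → Finset ι → (List ι → ℝ) → ℝ
  | 0, _, G => G []
  | n + 1, s, G => (∑ a ∈ s, permAvg n (s.erase a) (fun l => G (a :: l))) / (n + 1)

theorem permAvg_congr {n : ℕ} {s : Finset ι} (hs : s.card = n) {G G' : List ι → ℝ}
    (h : ∀ l : List ι, l.length = n → l.Nodup → (∀ a ∈ l, a ∈ s) → G l = G' l) :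
    permAvg n s G = permAvg n s G' := by
  induction n generalizing s G G' with
  | zero => exact h [] rfl List.nodup_nil (by simp)
  | succ n ih =>
    simp only [permAvg]
    congr 1
    refine Finset.sum_congr rfl fun a ha => ih (by simp [Finset.card_erase_of_mem ha, hs]) ?_
    intro l hl hnd hmem
    refine h _ (by simp [hl]) ?_ ?_
    · rw [List.nodup_cons]
      exact ⟨fun hal => by simpa using hmem a hal, hnd⟩
    · intro b hb
      rcases List.mem_cons.1 hb with rfl | hb
      · exact ha
      · exact Finset.mem_of_mem_erase (hmem b hb)

theorem permAvg_add (n : ℕ) (s : Finset ι) (G G' : List ι → ℝ) :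
    permAvg n s (fun l => G l + G' l) = permAvg n s G + permAvg n s G' := by
  induction n generalizing s G G' with
  | zero => rfl
  | succ n ih => simp only [permAvg, ih, Finset.sum_add_distrib, add_div]

theorem permAvg_const_mul (n : ℕ) (s : Finset ι) (c : ℝ) (G : List ι → ℝ) :
    permAvg n s (fun l => c * G l) = c * permAvg n s G := by
  induction n generalizing s G with
  | zero => rfl
  | succ n ih => simp only [permAvg, ih, ← Finset.mul_sum, mul_div_assoc]

theorem permAvg_const {n : ℕ} {s : Finset ι} (hs : s.card = n) (c : ℝ) :
    permAvg n s (fun _ => c) = c := by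
  induction n generalizing s with
  | zero => rfl
  | succ n ih =>
    simp only [permAvg]
    rw [Finset.sum_congr rfl fun a ha => ih (by simp [Finset.card_erase_of_mem ha, hs]),
      Finset.sum_const, hs]
    simp
    field_simp

theorem permAvg_sum {κ : Type*} (t : Finset κ) (n : ℕ) (s : Finset ι) (G : κ → List ι → ℝ) :
    permAvg n s (fun l => ∑ i ∈ t, G i l) = ∑ i ∈ t, permAvg n s (G i) := by
  classical
  induction n generalizing s G with
  | zero => rfl
  | succ n ih =>
    simp only [permAvg, ih, ← Finset.sum_div]
    rw [Finset.sum_comm]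

theorem permAvg_div (n : ℕ) (s : Finset ι) (c : ℝ) (G : List ι → ℝ) :
    permAvg n s (fun l => G l / c) = permAvg n s G / c := by
  simp only [div_eq_inv_mul, permAvg_const_mul]

theorem permAvg_comm {κ : Type*} [DecidableEq κ] (n m : ℕ) (s : Finset ι) (t : Finset κ)
    (F : List ι → List κ → ℝ) :
    permAvg n s (fun l => permAvg m t (F l)) =
      permAvg m t (fun l' => permAvg n s (fun l => F l l')) := by
  induction n generalizing s F with
  | zero => rfl
  | succ n ih =>
    simp only [permAvg, permAvg_div, permAvg_sum, ih]

/-- Splitting a random ordering of `s` by a predicate gives independent random orderings of the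
two parts. -/
theorem permAvg_filter (p : ι → Bool) (n : ℕ) :
    ∀ (s : Finset ι), s.card = n → ∀ (F : List ι → List ι → ℝ),
    permAvg n s (fun l => F (l.filter p) (l.filter (fun x => !p x))) =
      permAvg (s.filter (fun x => p x)).card (s.filter (fun x => p x)) (fun l =>
        permAvg (s.filter (fun x => ¬ p x)).card (s.filter (fun x => ¬ p x)) (F l)) := by
  induction n with
  | zero =>
    intro s hs F
    rw [Finset.card_eq_zero] at hs
    subst hs
    rfl
  | succ n ih =>
    intro s hs F
    have hsplit := Finset.card_filter_add_card_filter_not (s := s) (fun x => p x = true)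
    set s₁ := s.filter (fun x => p x) with hs₁
    set s₂ := s.filter (fun x => ¬ p x) with hs₂
    -- Sort the terms by the part containing the first element: part `i` contributes `|sᵢ|` times
    -- the right-hand side, and `|s₁| + |s₂| = n + 1`.
    rw [permAvg, div_eq_iff (by positivity)]
    rw [← Finset.sum_filter_add_sum_filter_not s (fun x => p x = true)]
    have e₁ : ∑ a ∈ s₁, permAvg n (s.erase a)
          (fun l => F ((a :: l).filter p) ((a :: l).filter (fun x => !p x))) =
        s₁.card * permAvg s₁.card s₁ (fun l => permAvg s₂.card s₂ (F l)) := by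
      rcases hc : s₁.card with _ | k
      · rw [Finset.card_eq_zero] at hc
        simp [hc]
      · rw [permAvg]
        push_cast
        rw [mul_div_cancel₀ _ (by positivity)]
        refine Finset.sum_congr rfl fun a ha => ?_
        have hpa : p a = true := (Finset.mem_filter.1 ha).2
        have has : a ∈ s := (Finset.mem_filter.1 ha).1
        have h1 : (s.erase a).filter (fun x => p x) = s₁.erase a := by
          rw [hs₁, Finset.filter_erase]
        have h2 : (s.erase a).filter (fun x => ¬ p x) = s₂ := by
          rw [hs₂, Finset.filter_erase, Finset.erase_eq_of_notMem]
          simp [hpa]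
        have := ih (s.erase a) (by simp [Finset.card_erase_of_mem has, hs])
          (fun l l' => F (a :: l) l')
        rw [h1, h2, Finset.card_erase_of_mem ha, hc] at this
        simpa [hpa] using this
    have e₂ : ∑ a ∈ s₂, permAvg n (s.erase a)
          (fun l => F ((a :: l).filter p) ((a :: l).filter (fun x => !p x))) =
        s₂.card * permAvg s₁.card s₁ (fun l => permAvg s₂.card s₂ (F l)) := by
      -- The average over `s₂` is brought outside, so that its recursion can be unfolded at the
      -- first element.
      rw [permAvg_comm]
      rcases hc : s₂.card with _ | k
      · rw [Finset.card_eq_zero] at hc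
        simp [hc]
      · rw [permAvg]
        push_cast
        rw [mul_div_cancel₀ _ (by positivity)]
        refine Finset.sum_congr rfl fun a ha => ?_
        have hpa : p a = false := by simpa using (Finset.mem_filter.1 ha).2
        have has : a ∈ s := (Finset.mem_filter.1 ha).1
        have h1 : (s.erase a).filter (fun x => p x) = s₁ := by
          rw [hs₁, Finset.filter_erase, Finset.erase_eq_of_notMem]
          simp [hpa]
        have h2 : (s.erase a).filter (fun x => ¬ p x) = s₂.erase a := by
          rw [hs₂, Finset.filter_erase]
        have := ih (s.erase a) (by simp [Finset.card_erase_of_mem has, hs])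
          (fun l l' => F l (a :: l'))
        rw [h1, h2, Finset.card_erase_of_mem ha, hc, permAvg_comm] at this
        simpa [hpa] using this
    rw [e₁, e₂, ← add_mul, mul_comm]
    congr 1
    exact_mod_cast hsplit.trans hs

end PermAvg

/-! ### Ranks of distinct keys -/

section Ranks

variable {ι β : Type*} [LinearOrder β]

/-- The ranks of distinct keys are `0, …, |s| - 1`, each once. In the induction the maximum has the
top rank and does not affect the other ranks. -/
theorem sum_card_filter_lt {s : Finset ι} {x : ι → β} (hx : Set.InjOn x s)
    (g : ℕ → ℝ) :
    ∑ a ∈ s, g (s.filter (fun b => x b < x a)).card = ∑ j ∈ Finset.range s.card, g j := by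
  classical
  induction s using Finset.induction_on_max_value x with
  | empty => simp
  | insert a s ha hmax ih =>
    have hxs : Set.InjOn x s := hx.mono (by simp)
    rw [Finset.sum_insert ha, Finset.card_insert_of_notMem ha, Finset.sum_range_succ, ← ih hxs,
      add_comm]
    have hlt : ∀ b ∈ s, x b < x a := fun b hb =>
      lt_of_le_of_ne (hmax b hb) fun h => ha <| by
        rwa [← hx (by simp [hb]) (by simp) h]
    congr 1
    · refine Finset.sum_congr rfl fun b hb => ?_
      rw [Finset.filter_insert, if_neg (not_lt.2 (hmax b hb))]
    · rw [Finset.filter_insert, if_neg (lt_irrefl _), Finset.filter_true_of_mem hlt]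

end Ranks

/-! ### Recursions for the first two moments -/

section Moments

variable {ι β : Type*} [DecidableEq ι] [LinearOrder β]

/-- The recursion of the average of a function of the number of key comparisons, according to the
rank of the pivot. -/
theorem permAvg_length_keyComparisons {s : Finset ι} {n : ℕ} (hs : s.card = n + 1) {x : ι → β}
    (φ : ℕ → ℝ) :
    permAvg (n + 1) s (fun l => φ (keyComparisons (l.map x)).length) =
      (∑ a ∈ s, permAvg ((s.erase a).filter (fun b => decide (x b < x a))).card
        ((s.erase a).filter (fun b => decide (x b < x a))) (fun l =>
          permAvg ((s.erase a).filter (fun b => ¬ decide (x b < x a))).card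
            ((s.erase a).filter (fun b => ¬ decide (x b < x a))) (fun l' =>
            φ (n + ((keyComparisons (l.map x)).length + (keyComparisons (l'.map x)).length))))) /
        (n + 1) := by
  rw [permAvg]
  congr 1
  refine Finset.sum_congr rfl fun a ha => ?_
  have hc : (s.erase a).card = n := by simp [Finset.card_erase_of_mem ha, hs]
  have := permAvg_filter (fun b => decide (x b < x a)) n (s.erase a) hc
    (fun l l' => φ (n + ((keyComparisons (l.map x)).length + (keyComparisons (l'.map x)).length)))
  rw [← this]
  refine permAvg_congr hc fun l hl _ _ => ?_
  rw [List.map_cons, keyComparisons]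
  simp only [List.length_append, List.length_map, hl, List.filter_map, Function.comp_def,
    decide_not]

/-- If `m` and `b` satisfy the recursions of the first two moments of the number of key
comparisons, then they are these moments for every set of distinct keys. -/
theorem permAvg_moments {m b : ℕ → ℝ} (m0 : m 0 = 0) (b0 : b 0 = 0)
    (hm : ∀ n : ℕ, m (n + 1) =
      (∑ j ∈ Finset.range (n + 1), (n + (m j + m (n - j)))) / (n + 1))
    (hb : ∀ n : ℕ, b (n + 1) =
      (∑ j ∈ Finset.range (n + 1), ((n : ℝ) ^ 2 + 2 * n * (m j + m (n - j)) + b j + b (n - j)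
        + 2 * (m j * m (n - j)))) / (n + 1)) (n : ℕ) :
    ∀ (s : Finset ι) (x : ι → β), Set.InjOn x s → s.card = n →
      permAvg n s (fun l => ((keyComparisons (l.map x)).length : ℝ)) = m n ∧
      permAvg n s (fun l => ((keyComparisons (l.map x)).length : ℝ) ^ 2) = b n := by
  induction n using Nat.strong_induction_on with
  | _ n ih =>
  intro s x hx hs
  cases n with
  | zero => simp [permAvg, keyComparisons, m0, b0]
  | succ n =>
  -- The rank `j` of the pivot is counted in `s` but the sublists live in `s.erase a`; the counts
  -- agree since the pivot is not smaller than itself.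
  have key : ∀ a ∈ s, ∃ j, j = (s.filter (fun b => x b < x a)).card ∧ j ≤ n ∧
      ((s.erase a).filter (fun b => decide (x b < x a))).card = j ∧
      ((s.erase a).filter (fun b => ¬ decide (x b < x a))).card = n - j := by
    intro a ha
    have h1 : (s.erase a).filter (fun b => x b < x a) = s.filter (fun b => x b < x a) := by
      rw [Finset.filter_erase, Finset.erase_eq_of_notMem]
      simp
    have h2 := Finset.card_filter_add_card_filter_not (s := s.erase a) (fun b => x b < x a)
    rw [Finset.card_erase_of_mem ha, hs, h1] at h2
    refine ⟨_, rfl, by omega, by simp only [decide_eq_true_eq, h1], ?_⟩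
    simp only [decide_eq_true_eq]
    omega
  have sub : ∀ (a : ι) (p : ι → Prop) [DecidablePred p],
      Set.InjOn x ((s.erase a).filter p : Finset ι) := fun a p _ =>
    hx.mono (by
      intro b hb
      have hb' := (Finset.mem_filter.1 (Finset.mem_coe.1 hb)).1
      exact Finset.mem_coe.2 (Finset.mem_of_mem_erase hb'))
  constructor
  · rw [permAvg_length_keyComparisons hs (fun k => (k : ℝ)), hm, ← hs,
      ← sum_card_filter_lt hx (fun j => (n + (m j + m (n - j))))]
    congr 1
    refine Finset.sum_congr rfl fun a ha => ?_
    obtain ⟨j, hj, hjn, c1, c2⟩ := key a ha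
    have i1 := (ih j (by omega) _ x (sub a _) c1).1
    have i2 := (ih (n - j) (by omega) _ x (sub a _) c2).1
    rw [c1, c2, ← hj]
    push_cast
    simp only [permAvg_add, permAvg_const c1, permAvg_const c2, i1, i2]
  · rw [permAvg_length_keyComparisons hs (fun k => (k : ℝ) ^ 2), hb, ← hs,
      ← sum_card_filter_lt hx (fun j => ((n : ℝ) ^ 2 + 2 * n * (m j + m (n - j)) + b j + b (n - j)
        + 2 * (m j * m (n - j))))]
    congr 1
    refine Finset.sum_congr rfl fun a ha => ?_
    obtain ⟨j, hj, hjn, c1, c2⟩ := key a ha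
    obtain ⟨i1, i1'⟩ := ih j (by omega) _ x (sub a _) c1
    obtain ⟨i2, i2'⟩ := ih (n - j) (by omega) _ x (sub a _) c2
    rw [c1, c2, ← hj]
    push_cast
    have e : ∀ u v : ℝ, (n + (u + v)) ^ 2 =
        (n : ℝ) ^ 2 + 2 * n * u + 2 * n * v + u ^ 2 + v ^ 2 + 2 * u * v := fun u v => by ring
    simp only [e]
    simp only [permAvg_add, permAvg_const_mul, permAvg_const c1, permAvg_const c2, i1, i2, i1', i2']
    have e2 := permAvg_const_mul j ((s.erase a).filter (fun b => decide (x b < x a)))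
      (2 * m (n - j)) (fun l => ((keyComparisons (l.map x)).length : ℝ))
    rw [i1] at e2
    have e3 : (fun l : List ι => 2 * ((keyComparisons (l.map x)).length : ℝ) * m (n - j)) =
      fun l => 2 * m (n - j) * ((keyComparisons (l.map x)).length : ℝ) := by
      funext l; ring
    rw [e3, e2]
    ring

end Moments

/-! ### Solving the recursions by harmonic numbers and generating functions -/

section ClosedForms

/-- The harmonic numbers. -/
noncomputable def harm (n : ℕ) : ℝ := ∑ i ∈ Finset.range n, 1 / ((i : ℝ) + 1)

/-- The harmonic numbers of second order. -/
noncomputable def harmSq (n : ℕ) : ℝ := ∑ i ∈ Finset.range n, 1 / ((i : ℝ) + 1) ^ 2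

theorem harm_zero : harm 0 = 0 := by simp [harm]
theorem harm_succ (n : ℕ) : harm (n + 1) = harm n + 1 / ((n : ℝ) + 1) := by
  simp [harm, Finset.sum_range_succ]
theorem harmSq_zero : harmSq 0 = 0 := by simp [harmSq]
theorem harmSq_succ (n : ℕ) : harmSq (n + 1) = harmSq n + 1 / ((n : ℝ) + 1) ^ 2 := by
  simp [harmSq, Finset.sum_range_succ]

/-- The mean number of key comparisons for `n` keys. -/
noncomputable def meanKey (n : ℕ) : ℝ := 2 * (n + 1) * harm n - 4 * n

/-- The variance of the number of key comparisons for `n` keys. -/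
noncomputable def varKey (n : ℕ) : ℝ :=
  7 * n ^ 2 - 4 * (n + 1) ^ 2 * harmSq n - 2 * (n + 1) * harm n + 13 * n

/-- The second moment of the number of key comparisons for `n` keys. -/
noncomputable def sqKey (n : ℕ) : ℝ := varKey n + meanKey n ^ 2

/-- This is the recursion of the mean, cleared of its denominator and symmetrised under `j ↦ n - 1 -
j`. -/
theorem sum_meanKey (n : ℕ) :
    2 * ∑ j ∈ Finset.range n, meanKey j = n * (meanKey n - n + 1) := by
  induction n with
  | zero => simp
  | succ n ih =>
    rw [Finset.sum_range_succ, mul_add, ih]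
    simp only [meanKey, harm_succ]
    push_cast
    field_simp
    ring

theorem meanKey_succ (n : ℕ) : meanKey (n + 1) =
    (∑ j ∈ Finset.range (n + 1), (n + (meanKey j + meanKey (n - j)))) / (n + 1) := by
  have hr : ∑ j ∈ Finset.range (n + 1), meanKey (n - j) =
      ∑ j ∈ Finset.range (n + 1), meanKey j := by
    simpa using Finset.sum_range_reflect meanKey (n + 1)
  have h := sum_meanKey (n + 1)
  rw [Finset.sum_add_distrib, Finset.sum_add_distrib, hr, eq_div_iff (by positivity)]
  simp only [Finset.sum_const, Finset.card_range, nsmul_eq_mul]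
  push_cast at *
  linarith

open PowerSeries in
theorem coeff_succ_mul_one_sub_X (f : ℝ⟦X⟧) (n : ℕ) :
    coeff (n + 1) (f * (1 - X)) = coeff (n + 1) f - coeff n f := by
  rw [mul_sub, mul_one, map_sub, coeff_succ_mul_X]

open PowerSeries in
theorem coeff_zero_mul_one_sub_X (f : ℝ⟦X⟧) : coeff 0 (f * (1 - X)) = coeff 0 f := by
  simp [mul_sub]

/-- The power series of `-log (1 - X)`. -/
noncomputable def logSeries : PowerSeries ℝ := PowerSeries.mk fun n => 1 / (n : ℝ)

open PowerSeries in
theorem mk_harm_mul : (mk harm : ℝ⟦X⟧) * (1 - X) = logSeries := by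
  ext n
  cases n with
  | zero => rw [coeff_zero_mul_one_sub_X]; simp [logSeries, harm_zero]
  | succ n => rw [coeff_succ_mul_one_sub_X]; simp [logSeries, harm_succ]

theorem one_sub_X_ne_zero : (1 - PowerSeries.X : PowerSeries ℝ) ≠ 0 := by
  intro h
  simpa using congrArg (PowerSeries.coeff 0) h

open PowerSeries in
theorem derivative_logSeries_mul : derivative ℝ logSeries * (1 - X) = 1 := by
  ext n
  have h : ∀ n, coeff n (derivative ℝ logSeries) = 1 := fun n => by
    rw [coeff_derivative]
    simp only [logSeries, coeff_mk]
    push_cast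
    field_simp
  cases n with
  | zero => rw [coeff_zero_mul_one_sub_X, h]; simp
  | succ n => rw [coeff_succ_mul_one_sub_X, h, h]; simp [coeff_one]

open PowerSeries in
-- With `L = -log (1 - X)`, the derivative of `L²` is `2 L / (1 - X)`, which is twice the generating
-- function of the harmonic numbers.
theorem coeff_logSeries_sq (n : ℕ) :
    coeff (n + 1) (logSeries ^ 2) = 2 * harm n / (n + 1) := by
  have h : derivative ℝ (logSeries ^ 2) = 2 * (mk harm : ℝ⟦X⟧) := by
    apply mul_right_cancel₀ one_sub_X_ne_zero
    rw [Derivation.leibniz_pow, mul_assoc, mk_harm_mul]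
    simp only [smul_eq_mul, nsmul_eq_mul, Nat.add_one_sub_one, pow_one]
    rw [mul_assoc, mul_assoc, derivative_logSeries_mul]
    simp
  have h2 := congrArg (coeff n) h
  rw [coeff_derivative] at h2
  rw [eq_div_iff (by positivity), h2, two_mul, two_mul]
  simp

open PowerSeries in
theorem mk_meanKey_mul : (mk meanKey : ℝ⟦X⟧) * (1 - X) * (1 - X) = 2 * (logSeries - X) := by
  have e2 : (2 : ℝ⟦X⟧) = C 2 := (map_ofNat C 2).symm
  ext n
  rw [e2, coeff_C_mul]
  rcases n with _ | _ | n
  · simp [coeff_zero_mul_one_sub_X, meanKey, logSeries, harm_zero]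
  · rw [coeff_succ_mul_one_sub_X, coeff_succ_mul_one_sub_X, coeff_zero_mul_one_sub_X]
    simp [meanKey, logSeries, harm_succ, harm_zero]
    norm_num
  · rw [coeff_succ_mul_one_sub_X, coeff_succ_mul_one_sub_X, coeff_succ_mul_one_sub_X]
    simp only [coeff_mk, meanKey, harm_succ, logSeries, map_sub, coeff_X]
    rw [if_neg (by omega)]
    push_cast
    field_simp
    ring

/-- The convolution `∑ j < n, meanKey j * meanKey (n - 1 - j)` in closed form. -/
noncomputable def convKey (n : ℕ) : ℝ :=
  4 * (n * (n + 1) * (n + 2) / 6 * (harm n ^ 2 - harmSq n)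
    + n / 6 * (2 * (2 * n + 3) - 11 / 3 * (n + 1) * (n + 2)) * harm n
    + n / 6 * (2 - 11 / 3 * (2 * n + 3) + 85 / 18 * (n + 1) * (n + 2))
    - (n + 1) * n * (n - 1) / 3 * (harm n - 11 / 6) - n * (n - 1) / 3
    + n * (n - 1) * (n - 2) / 6)

set_option maxHeartbeats 4000000 in
open PowerSeries in
-- The means have generating function `2 (L - X) / (1 - X)²`, so their convolution has the square of
-- it. Clearing the denominator turns the claim into an identity for fourth differences of
-- `convKey`.
theorem mk_convKey_mul : (mk (fun n => convKey (n + 1)) : ℝ⟦X⟧) * (1 - X) * (1 - X) * (1 - X)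
    * (1 - X) = 4 * (logSeries ^ 2 - 2 * (logSeries * X) + X ^ 2) := by
  have e2 : (2 : ℝ⟦X⟧) = C 2 := (map_ofNat C 2).symm
  have e4 : (4 : ℝ⟦X⟧) = C 4 := (map_ofNat C 4).symm
  ext n
  rw [e2, e4, coeff_C_mul, map_add, map_sub, coeff_C_mul, coeff_X_pow]
  -- A fourth difference reaches back four indices, so the coefficients below `4` are computed
  -- separately.
  rcases n with _ | _ | _ | _ | n
  · simp [coeff_zero_mul_one_sub_X, convKey, logSeries, harm_zero, harm_succ, harmSq_succ,
      harmSq_zero]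
    norm_num
  · rw [coeff_logSeries_sq, coeff_succ_mul_X]
    simp [coeff_zero_mul_one_sub_X, coeff_succ_mul_one_sub_X, convKey, logSeries, harm_zero,
      harm_succ, harmSq_succ, harmSq_zero]
    norm_num
  · rw [coeff_logSeries_sq, coeff_succ_mul_X]
    simp [coeff_zero_mul_one_sub_X, coeff_succ_mul_one_sub_X, convKey, logSeries, harm_zero,
      harm_succ, harmSq_succ, harmSq_zero]
    norm_num
  · rw [coeff_logSeries_sq, coeff_succ_mul_X]
    simp [coeff_zero_mul_one_sub_X, coeff_succ_mul_one_sub_X, convKey, logSeries, harm_zero,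
      harm_succ, harmSq_succ, harmSq_zero]
    norm_num
  · rw [coeff_logSeries_sq, coeff_succ_mul_X, if_neg (by omega)]
    simp only [coeff_succ_mul_one_sub_X, coeff_mk, convKey, harm_succ, harmSq_succ, logSeries]
    push_cast
    field_simp
    ring

open PowerSeries in
theorem sum_meanKey_mul (n : ℕ) :
    ∑ j ∈ Finset.range (n + 1), meanKey j * meanKey (n - j) = convKey (n + 1) := by
  have h : (mk meanKey : ℝ⟦X⟧) * mk meanKey = mk (fun n => convKey (n + 1)) := by
    have hX := one_sub_X_ne_zero
    have := mk_meanKey_mul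
    have h4 := mk_convKey_mul
    have : ((mk meanKey : ℝ⟦X⟧) * mk meanKey) * (1 - X) * (1 - X) * (1 - X) * (1 - X) =
        mk (fun n => convKey (n + 1)) * (1 - X) * (1 - X) * (1 - X) * (1 - X) := by
      rw [h4]
      calc _ = ((mk meanKey : ℝ⟦X⟧) * (1 - X) * (1 - X)) ^ 2 := by ring
        _ = _ := by rw [this]; ring
    exact mul_right_cancel₀ hX (mul_right_cancel₀ hX (mul_right_cancel₀ hX
      (mul_right_cancel₀ hX this)))
  have h2 := congrArg (coeff n) h
  rw [coeff_mul, Finset.Nat.sum_antidiagonal_eq_sum_range_succ_mk] at h2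
  simpa using h2

/-- The recursion of the second moment in summed form, with `sum_meanKey` already substituted for
the sum of the means. -/
theorem sum_sqKey (n : ℕ) :
    2 * ∑ j ∈ Finset.range n, sqKey j =
      n * sqKey n - 2 * (n - 1) * n * meanKey n + n * (n - 1) ^ 2 - 2 * convKey n := by
  induction n with
  | zero => simp [convKey]
  | succ n ih =>
    rw [Finset.sum_range_succ, mul_add, ih]
    simp only [sqKey, varKey, convKey, meanKey, harm_succ, harmSq_succ]
    push_cast
    field_simp
    ring

theorem sqKey_succ (n : ℕ) : sqKey (n + 1) =
    (∑ j ∈ Finset.range (n + 1), ((n : ℝ) ^ 2 + 2 * n * (meanKey j + meanKey (n - j))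
      + sqKey j + sqKey (n - j) + 2 * (meanKey j * meanKey (n - j)))) / (n + 1) := by
  have hr : ∑ j ∈ Finset.range (n + 1), meanKey (n - j) =
      ∑ j ∈ Finset.range (n + 1), meanKey j := by
    simpa using Finset.sum_range_reflect meanKey (n + 1)
  have hr' : ∑ j ∈ Finset.range (n + 1), sqKey (n - j) =
      ∑ j ∈ Finset.range (n + 1), sqKey j := by
    simpa using Finset.sum_range_reflect sqKey (n + 1)
  have h := sum_meanKey (n + 1)
  have h' := sum_sqKey (n + 1)
  simp only [Finset.sum_add_distrib, ← Finset.mul_sum, sum_meanKey_mul]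
  rw [hr, hr', eq_div_iff (by positivity)]
  simp only [Finset.sum_const, Finset.card_range, nsmul_eq_mul]
  push_cast at *
  linear_combination (-2 * (n : ℝ)) * h - h'

end ClosedForms

/-! ### Quadratic lower bound for the variance -/

section Asymptotics

theorem harmSq_le (n : ℕ) : harmSq n ≤ Real.pi ^ 2 / 6 := by
  have h := hasSum_zeta_two
  have h2 := (hasSum_nat_add_iff' 1).2 h
  simp only [Finset.sum_range_one, Nat.cast_zero] at h2
  norm_num at h2
  have := sum_le_hasSum (Finset.range n) (fun i _ => by positivity) h2
  simpa [harmSq] using this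

/-- A crude substitute for logarithmic growth: while `n < 1 / δ` the trivial bound `harm n ≤ n`
suffices, and afterwards each increment is at most `δ`. -/
theorem harm_le (n : ℕ) {δ : ℝ} (hδ : 0 < δ) : harm n ≤ δ * n + 1 / δ := by
  induction n with
  | zero => simp [harm_zero]; positivity
  | succ n ih =>
    by_cases h : 1 / ((n : ℝ) + 1) ≤ δ
    · rw [harm_succ]; push_cast; linarith
    · have hn : ((n : ℝ) + 1) < 1 / δ := by
        rw [not_le, lt_div_iff₀ (by positivity)] at h
        rw [lt_div_iff₀ hδ]; linarith
      have h1 : harm (n + 1) ≤ ((n + 1 : ℕ) : ℝ) := by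
        unfold harm
        calc _ ≤ ∑ i ∈ Finset.range (n + 1), (1 : ℝ) := Finset.sum_le_sum fun i _ => by
              rw [div_le_one (by positivity)]; linarith [(Nat.cast_nonneg i : (0:ℝ) ≤ i)]
          _ = _ := by simp
      push_cast at *
      nlinarith [mul_nonneg hδ.le (Nat.cast_nonneg n : (0:ℝ) ≤ n)]

theorem exists_varKey_ge {ε : ℝ} (hε : 0 < ε) :
    ∃ C : ℝ, ∀ n : ℕ, (7 - 2 * Real.pi ^ 2 / 3 - ε) * n ^ 2 - C ≤ varKey n := by
  have hπ : Real.pi ^ 2 / 6 ≤ 2 := by nlinarith [Real.pi_lt_d2, Real.pi_pos]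
  set δ := ε / 8 with hδ
  have hδ0 : 0 < δ := by positivity
  -- After the bounds on the harmonic numbers, the linear terms to be absorbed add up to `-(3 + 2δ +
  -- 2/δ) n`; completing the square trades them for `δ n²` and the first summand. The total
  -- quadratic loss is `3δ ≤ ε`.
  refine ⟨(3 + 2 * δ + 2 / δ) ^ 2 / (4 * δ) + 8 + 2 / δ, fun n => ?_⟩
  have h1 := harmSq_le n
  have h2 := harm_le n hδ0
  have hn : (0 : ℝ) ≤ n := Nat.cast_nonneg n
  have e1 : 4 * ((n : ℝ) + 1) ^ 2 * harmSq n ≤ 4 * ((n : ℝ) + 1) ^ 2 * (Real.pi ^ 2 / 6) := by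
    gcongr
  have e2 : 2 * ((n : ℝ) + 1) * harm n ≤ 2 * ((n : ℝ) + 1) * (δ * n + 1 / δ) := by
    gcongr
  have e3 : (3 + 2 * δ + 2 / δ) * n ≤ δ * n ^ 2 + (3 + 2 * δ + 2 / δ) ^ 2 / (4 * δ) := by
    have : 0 ≤ δ * (n - (3 + 2 * δ + 2 / δ) / (2 * δ)) ^ 2 := by positivity
    have e : δ * (n - (3 + 2 * δ + 2 / δ) / (2 * δ)) ^ 2 =
      δ * n ^ 2 - (3 + 2 * δ + 2 / δ) * n + (3 + 2 * δ + 2 / δ) ^ 2 / (4 * δ) := by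
      field_simp
      ring
    linarith
  have e5 : 2 / δ = 2 * (1 / δ) := by ring
  unfold varKey
  have hε' : ε = 8 * δ := by rw [hδ]; ring
  rw [hε']
  rw [e5] at e3 ⊢
  set r := 1 / δ
  have e4 : 4 * ((n:ℝ) + 1) ^ 2 * (Real.pi ^ 2 / 6) ≤
      (2 * Real.pi ^ 2 / 3) * n ^ 2 + 16 * n + 8 := by nlinarith
  nlinarith [mul_nonneg hδ0.le (sq_nonneg (n:ℝ))]

theorem sigma_sq_pos : 0 < 7 - 2 * Real.pi ^ 2 / 3 := by
  nlinarith [Real.pi_lt_d2, Real.pi_pos]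

end Asymptotics

/-! ### Measurability of agreement and prefix events -/

section MeasurableSets

variable {α : Type*} [Finite α] [MeasurableSpace α] [MeasurableSingletonClass α]

theorem measurableSet_comparesSymbol (k : ℕ) :
    MeasurableSet {z : (ℕ → α) × (ℕ → α) | ComparesSymbol k z.1 z.2} := by
  have : {z : (ℕ → α) × (ℕ → α) | ComparesSymbol k z.1 z.2} =
      ⋂ i, ⋂ (_ : i < k), {z | z.1 i = z.2 i} := by ext; simp [ComparesSymbol]
  rw [this]
  exact MeasurableSet.iInter fun i => MeasurableSet.iInter fun _ =>
    measurableSet_eq_fun (by fun_prop) (by fun_prop)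

theorem measurableSet_hasPrefix {k : ℕ} (w : Fin k → α) :
    MeasurableSet {u : ℕ → α | HasPrefix w u} := by
  have : {u : ℕ → α | HasPrefix w u} = ⋂ i, {u | u (i : ℕ) = w i} := by ext; simp [HasPrefix]
  rw [this]
  exact MeasurableSet.iInter fun i => measurableSet_eq_fun (by fun_prop) (by fun_prop)

end MeasurableSets

/-! ### Measurability and level decomposition of the counts -/

section Measurability

/-- Sorting lists of indices instead of keys makes each sublist a random element of a countable
discrete space, so that the recursive calls can be treated one index list at a time. -/
theorem measurable_countP_keyComparisons {S β ι : Type*} [MeasurableSpace S] [LinearOrder β]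
    [Countable ι] {x : S → ι → β} (hlt : ∀ i j, MeasurableSet {s | x s i < x s j})
    {q : β × β → Bool} (hq : ∀ i j, MeasurableSet {s | q (x s i, x s j) = true}) (n : ℕ) :
    ∀ l : List ι, l.length ≤ n →
      Measurable fun s => (keyComparisons (l.map (x s))).countP q := by
  let _ : MeasurableSpace (List ι) := ⊤
  have : DiscreteMeasurableSpace (List ι) := ⟨fun _ => trivial⟩
  have hfilter : ∀ (p : S → ι → Bool), (∀ i, MeasurableSet {s | p s i = true}) → ∀ l : List ι,
      Measurable fun s => l.filter (p s) := by
    intro p hp l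
    induction l with
    | nil => simp
    | cons a l ih =>
      simp only [List.filter_cons]
      exact Measurable.ite (hp a) ((Measurable.of_discrete (f := fun t : List ι => a :: t)).comp ih)
        ih
  induction n with
  | zero =>
    intro l hl
    rw [List.eq_nil_of_length_eq_zero (by omega : l.length = 0)]
    simp [keyComparisons]
  | succ n ih =>
    intro l hl
    cases l with
    | nil => simp [keyComparisons]
    | cons a l =>
      simp only [List.length_cons] at hl
      have hcomp : ∀ (p : S → ι → Bool), (∀ i, MeasurableSet {s | p s i = true}) →
          Measurable fun s => (keyComparisons ((l.filter (p s)).map (x s))).countP q := by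
        intro p hp
        -- The cut-off at length `n` makes the induction hypothesis available for every list; it is
        -- inactive on the sublists that occur.
        have h1 : Measurable fun z : S × List ι =>
            if z.2.length ≤ n then (keyComparisons (z.2.map (x z.1))).countP q else 0 := by
          refine measurable_from_prod_countable_left fun t => ?_
          by_cases ht : t.length ≤ n
          · simpa [ht] using ih t ht
          · simp [ht]
        have h2 := h1.comp (measurable_id.prodMk (hfilter p hp l))
        convert h2 using 2 with s
        have : (l.filter (p s)).length ≤ n := (List.length_filter_le _ _).trans (by omega)
        simp [this]
      have hcount : ∀ t : List ι, Measurable fun s => (t.map (x s)).countP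
          (fun u => q (u, x s a)) := by
        intro t
        induction t with
        | nil => simp
        | cons b t iht =>
          simp only [List.map_cons, List.countP_cons]
          exact iht.add (Measurable.ite (hq b a) measurable_const measurable_const)
      have h1 := hcomp (fun s i => decide (x s i < x s a)) (fun i => by simpa using hlt i a)
      have h2 := hcomp (fun s i => !decide (x s i < x s a)) (fun i => by
        simp only [Bool.not_eq_true', decide_eq_false_iff_not]
        exact (hlt i a).compl)
      simp only [List.map_cons, keyComparisons, List.countP_append, List.countP_map,
        List.filter_map, Function.comp_def, decide_not]
      simp only [List.countP_map, Function.comp_def] at hcount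
      exact (hcount l).add (h1.add h2)

variable {α : Type*} [LinearOrder α]

theorem comparisons_countP (q : (ℕ → α) × (ℕ → α) → Bool) (x : ℕ → ℕ → α) (n : ℕ) :
    (comparisons x n).countP q =
      (keyComparisons ((List.range n).map (fun i => toLex (x i)))).countP
        (fun uv => q (ofLex uv.1, ofLex uv.2)) := by
  rw [comparisons, List.countP_map]
  rfl

theorem levelCount_zero (x : ℕ → ℕ → α) (n : ℕ) : levelCount 0 x n = keyCount x n := by
  simp [levelCount, keyCount, ComparesSymbol]

theorem keyCount_le (x : ℕ → ℕ → α) (n : ℕ) : keyCount x n ≤ n ^ 2 := by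
  rw [keyCount, comparisons, List.length_map]
  exact length_keyComparisons_le n _ (by simp)

theorem levelCount_le (k : ℕ) (x : ℕ → ℕ → α) (n : ℕ) : levelCount k x n ≤ n ^ 2 :=
  List.countP_le_length.trans (keyCount_le x n)

theorem levelCount_eq_zero {k : ℕ} {x : ℕ → ℕ → α} {n : ℕ}
    (h : ∀ i j, i < j → j < n → ¬ ComparesSymbol k (x j) (x i)) : levelCount k x n = 0 := by
  rw [levelCount, comparisons_countP]
  refine countP_keyComparisons_eq_zero _ n _ (by simp) ?_
  rw [List.pairwise_map]
  refine List.Pairwise.imp_of_mem ?_ (List.pairwise_lt_range (n := n))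
  intro i j _ hj hij
  exact decide_eq_false (h i j hij (by simpa using hj))

/-- Two words agreeing in their first `k` symbols share exactly one prefix of length `k`. -/
theorem levelCount_eq_sum_prefixCount [Fintype α] (k : ℕ) (x : ℕ → ℕ → α) (n : ℕ) :
    levelCount k x n = ∑ w : Fin k → α, prefixCount w x n := by
  simp only [levelCount, prefixCount]
  induction comparisons x n with
  | nil => simp
  | cons uv l ih =>
    simp only [List.countP_cons, Finset.sum_add_distrib, ih]
    congr 1
    by_cases h : ComparesSymbol k uv.1 uv.2
    · have : ∀ w : Fin k → α, (ComparesSymbol k uv.1 uv.2 ∧ HasPrefix w uv.1 ∧ HasPrefix w uv.2) ↔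
          w = fun i : Fin k => uv.1 i := by
        intro w
        constructor
        · rintro ⟨-, h1, -⟩
          funext i
          exact (h1 i).symm
        · rintro rfl
          exact ⟨h, fun i => rfl, fun i => (h i i.2).symm⟩
      simp only [decide_eq_true_eq, this]
      simp [h]
    · simp [h]

theorem toENNReal_symbolCost (u v : ℕ → α) :
    ((symbolCost u v : ℕ∞) : ℝ≥0∞) = ∑' k, if ComparesSymbol k u v then 1 else 0 := by
  rw [symbolCost, ← ENNReal.tsum_set_one, tsum_subtype _ (fun _ => (1 : ℝ≥0∞))]
  simp [Set.indicator_apply]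

/-- Stated in `[0, ∞]`, where exchanging the sums over comparisons and levels raises no convergence
question. -/
theorem toENNReal_symbolCount (x : ℕ → ℕ → α) (n : ℕ) :
    ((symbolCount x n : ℕ∞) : ℝ≥0∞) = ∑' k, (levelCount k x n : ℝ≥0∞) := by
  simp only [symbolCount, levelCount]
  induction comparisons x n with
  | nil => simp
  | cons uv l ih =>
    simp only [List.map_cons, List.sum_cons, List.countP_cons]
    push_cast
    rw [ENNReal.tsum_add, ih, toENNReal_symbolCost, add_comm]
    simp

variable [Finite α] [MeasurableSpace α] [MeasurableSingletonClass α]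

theorem measurableSet_toLex_lt :
    MeasurableSet {z : (ℕ → α) × (ℕ → α) | toLex z.1 < toLex z.2} := by
  have : {z : (ℕ → α) × (ℕ → α) | toLex z.1 < toLex z.2} =
      ⋃ k : ℕ, {z | (∀ i < k, z.1 i = z.2 i) ∧ z.1 k < z.2 k} := by
    ext z
    simp only [Set.mem_ofPred_eq, Set.mem_iUnion]
    exact Iff.rfl
  rw [this]
  refine MeasurableSet.iUnion fun k => MeasurableSet.inter ?_ ?_
  · have : {z : (ℕ → α) × (ℕ → α) | ∀ i < k, z.1 i = z.2 i} =
        ⋂ i, ⋂ (_ : i < k), {z | z.1 i = z.2 i} := by ext; simp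
    change MeasurableSet {z : (ℕ → α) × (ℕ → α) | ∀ i < k, z.1 i = z.2 i}
    rw [this]
    exact MeasurableSet.iInter fun i => MeasurableSet.iInter fun _ =>
      measurableSet_eq_fun (by fun_prop) (by fun_prop)
  · have h : Measurable fun z : (ℕ → α) × (ℕ → α) => (z.1 k, z.2 k) := by fun_prop
    exact h (MeasurableSet.of_discrete (s := {p : α × α | p.1 < p.2}))

theorem measurable_countP_map {ι : Type*} [Countable ι] {q : (ℕ → α) × (ℕ → α) → Bool}
    (hq : MeasurableSet {z | q z = true}) (l : List ι) :
    Measurable fun y : ι → ℕ → α => (keyComparisons (l.map (fun i => toLex (y i)))).countP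
      (fun uv => q (ofLex uv.1, ofLex uv.2)) := by
  refine measurable_countP_keyComparisons (x := fun (y : ι → ℕ → α) i => toLex (y i))
    (fun i j => ?_) (fun i j => ?_) l.length l le_rfl
  · have h : Measurable fun y : ι → ℕ → α => (y i, y j) := by fun_prop
    exact h measurableSet_toLex_lt
  · have h : Measurable fun y : ι → ℕ → α => (y i, y j) := by fun_prop
    exact h hq

theorem measurable_length_map {ι : Type*} [Countable ι] (l : List ι) :
    Measurable fun y : ι → ℕ → α => (keyComparisons (l.map (fun i => toLex (y i)))).length := by
  simpa using measurable_countP_map (α := α) (q := fun _ => true) (by simp) l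

theorem measurable_levelCount (k n : ℕ) :
    Measurable fun x : ℕ → ℕ → α => levelCount k x n := by
  simp only [levelCount, comparisons_countP]
  exact measurable_countP_map (q := fun uv => decide (ComparesSymbol k uv.1 uv.2))
    (by simpa using measurableSet_comparesSymbol k) _

theorem measurable_keyCount (n : ℕ) : Measurable fun x : ℕ → ℕ → α => keyCount x n := by
  simpa only [levelCount_zero] using measurable_levelCount (α := α) 0 n

theorem measurable_prefixCount {k : ℕ} (w : Fin k → α) (n : ℕ) :
    Measurable fun x : ℕ → ℕ → α => prefixCount w x n := by
  simp only [prefixCount, comparisons_countP]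
  refine measurable_countP_map (q := fun uv => decide (ComparesSymbol k uv.1 uv.2 ∧
    HasPrefix w uv.1 ∧ HasPrefix w uv.2)) ?_ _
  simp only [decide_eq_true_eq]
  exact (measurableSet_comparesSymbol k).inter
    ((measurable_fst (measurableSet_hasPrefix w)).inter
      (measurable_snd (measurableSet_hasPrefix w)))

end Measurability

/-! ### Moments of the Poisson distribution -/

section Poisson

open scoped Nat in
theorem integrable_pow_poissonMeasure (t : ℝ≥0) (k : ℕ) :
    Integrable (fun n : ℕ => (n : ℝ) ^ k) (poissonMeasure t) := by
  rw [integrable_poissonMeasure_iff]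
  have hs : Summable fun n : ℕ => Real.exp (-t) * k ! * ((Real.exp 1 * t) ^ n / (n ! : ℝ)) :=
    (Real.summable_pow_div_factorial _).mul_left _
  refine Summable.of_nonneg_of_le (fun n => by positivity) (fun n => ?_) hs
  -- From `n ^ k ≤ k! eⁿ` the series is dominated by an exponential series in `e t`.
  have h := Real.pow_div_factorial_le_exp n (Nat.cast_nonneg n) k
  rw [div_le_iff₀ (by positivity)] at h
  rw [Real.norm_of_nonneg (by positivity), mul_pow, ← Real.exp_nat_mul, mul_one]
  calc _ ≤ Real.exp (-t) * t ^ n / (n ! : ℝ) * (Real.exp n * k !) := by gcongr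
    _ = _ := by ring

theorem sq_le_integral_sq_poissonMeasure (t : ℝ≥0) :
    (t : ℝ) ^ 2 ≤ ∫ n : ℕ, (n : ℝ) ^ 2 ∂(poissonMeasure t) := by
  have h1 := hasSum_integral_poissonMeasure (integrable_pow_poissonMeasure t 2)
  have h2 := (hasSum_one_poissonMeasure t).mul_left ((t : ℝ) ^ 2)
  -- Termwise form of `E N² ≥ E N(N - 1) = t²`: the weight at `n + 2`, times `(n + 2)²`, exceeds
  -- `t²` times the weight at `n`.
  have h1' := (hasSum_nat_add_iff' 2).2 h1
  have h3 := hasSum_le (fun n => ?_) h2 h1'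
  · simp [Finset.sum_range_succ] at h3
    have : 0 ≤ Real.exp (-t) * (t : ℝ) := by positivity
    linarith
  · simp only [smul_eq_mul]
    rw [Nat.factorial_succ, Nat.factorial_succ]
    push_cast
    have e : Real.exp (-t) * (t : ℝ) ^ (n + 2) / (((n : ℝ) + 1 + 1) * (((n : ℝ) + 1) * n.factorial))
        * ((n : ℝ) + 2) ^ 2 = (t : ℝ) ^ 2 * (Real.exp (-t) * t ^ n / n.factorial)
          * (((n : ℝ) + 2) / (n + 1)) := by
      field_simp
      ring
    rw [e]
    refine le_mul_of_one_le_right (by positivity) ?_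
    rw [le_div_iff₀ (by positivity)]
    linarith

theorem lintegral_pow_poissonMeasure_lt_top (t : ℝ≥0) (k : ℕ) :
    ∫⁻ n : ℕ, (n : ℝ≥0∞) ^ k ∂(poissonMeasure t) < ∞ := by
  have h := (integrable_pow_poissonMeasure t k).2
  rw [hasFiniteIntegral_iff_enorm] at h
  simpa using h

end Poisson

/-! ### Random keys: coincidences, exact moments, conditioning on the arrivals -/

section Keys

variable {α : Type*} [Fintype α] [LinearOrder α] [MeasurableSpace α] [MeasurableSingletonClass α]
  {Ω : Type*} [MeasurableSpace Ω] {P : Measure Ω} {μ : Measure (ℕ → α)}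
  {X : ℕ → Ω → ℕ → α} {N : ℝ≥0 → Ω → ℕ}

/-- The probability that two independent words agree in their first `k` symbols. -/
noncomputable def coincidence (μ : Measure (ℕ → α)) (k : ℕ) : ℝ :=
  ∑ w : Fin k → α, prefixProb μ w ^ 2

theorem coincidence_nonneg (μ : Measure (ℕ → α)) (k : ℕ) : 0 ≤ coincidence μ k :=
  Finset.sum_nonneg fun _ _ => sq_nonneg _

theorem tendsto_coincidence (hsum : Summable fun k : ℕ => √(coincidence μ k)) :
    Tendsto (coincidence μ) atTop (𝓝 0) := by
  have h := hsum.tendsto_atTop_zero.pow 2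
  simpa [Real.sq_sqrt (coincidence_nonneg μ _)] using h

/-- Agreement in `k` symbols means a common prefix `w`, and by independence both words have it with
probability `p_w²`. -/
theorem measure_comparesSymbol_le [IsProbabilityMeasure μ] (hmodel : IsPoissonKeyModel μ X N P)
    (k : ℕ) {i j : ℕ} (hij : i ≠ j) :
    P {ω | ComparesSymbol k (X i ω) (X j ω)} ≤ ENNReal.ofReal (coincidence μ k) := by
  have hsub : {ω | ComparesSymbol k (X i ω) (X j ω)} ⊆
      ⋃ w : Fin k → α, X i ⁻¹' {u | HasPrefix w u} ∩ X j ⁻¹' {u | HasPrefix w u} := by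
    intro ω h
    refine Set.mem_iUnion.2 ⟨fun l => X i ω l, fun l => rfl, fun l => (h l l.2).symm⟩
  refine (measure_mono hsub).trans ((measure_iUnion_fintype_le _ _).trans ?_)
  rw [coincidence, ENNReal.ofReal_sum_of_nonneg fun _ _ => sq_nonneg _]
  refine Finset.sum_le_sum fun w _ => ?_
  have hw := measurableSet_hasPrefix w
  rw [(hmodel.indep.indepFun hij).measure_inter_preimage_eq_mul _ _ hw hw,
    ← Measure.map_apply (hmodel.measurable i) hw, ← Measure.map_apply (hmodel.measurable j) hw,
    (hmodel.keyLaw i).map_eq, (hmodel.keyLaw j).map_eq, prefixProb,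
    ENNReal.ofReal_pow measureReal_nonneg, ofReal_measureReal, sq]

theorem ae_injective_keys [IsProbabilityMeasure μ] (hmodel : IsPoissonKeyModel μ X N P)
    (hsum : Summable fun k : ℕ => √(coincidence μ k)) :
    ∀ᵐ ω ∂P, Function.Injective fun i => X i ω := by
  have h : ∀ i j : ℕ, i ≠ j → ∀ᵐ ω ∂P, X i ω ≠ X j ω := by
    intro i j hij
    have h0 : Tendsto (fun k => ENNReal.ofReal (coincidence μ k)) atTop (𝓝 0) := by
      simpa using ENNReal.tendsto_ofReal (tendsto_coincidence hsum)
    have h1 : P {ω | X i ω = X j ω} ≤ 0 := by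
      refine ge_of_tendsto' h0 fun k => ?_
      refine (measure_mono fun ω hω => ?_).trans (measure_comparesSymbol_le hmodel k hij)
      intro l _
      exact congrFun hω l
    rw [ae_iff]
    simpa using h1
  have h' : ∀ᵐ ω ∂P, ∀ i j : ℕ, i ≠ j → X i ω ≠ X j ω := by
    rw [ae_all_iff]
    intro i
    rw [ae_all_iff]
    intro j
    by_cases hij : i = j
    · simp [hij]
    · simpa [hij] using h i j hij
  filter_upwards [h'] with ω hω i j hij
  by_contra hne
  exact hω i j hne hij

/-- The law of the number of key comparisons for a list of different keys depends only on the
length of the list. -/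
theorem integral_length_keyComparisons_congr [IsProbabilityMeasure P]
    (hmodel : IsPoissonKeyModel μ X N P) (φ : ℕ → ℝ) {l : List ℕ} (hl : l.Nodup) :
    ∫ ω, φ (keyComparisons (l.map (fun i => toLex (X i ω)))).length ∂P =
      ∫ y, φ (keyComparisons ((List.finRange l.length).map (fun i => toLex (y i)))).length
        ∂(Measure.pi fun _ : Fin l.length => μ) := by
  have hinj : Function.Injective l.get := List.nodup_iff_injective_get.1 hl
  have hlaw := (iIndepFun_iff_map_fun_eq_pi_map
    (fun i => (hmodel.measurable (l.get i)).aemeasurable)).1 (hmodel.indep.precomp hinj)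
  simp only [(hmodel.keyLaw _).map_eq] at hlaw
  rw [← hlaw, integral_map]
  · congr with ω
    congr 3
    exact List.ext_getElem (by simp) (by intros; simp)
  · exact (measurable_pi_lambda _ fun i => hmodel.measurable _).aemeasurable
  · exact ((Measurable.of_discrete (f := φ)).comp
      (measurable_length_map _)).aestronglyMeasurable

theorem measurable_keys (hmodel : IsPoissonKeyModel μ X N P) :
    Measurable fun ω i => X i ω :=
  measurable_pi_lambda _ fun i => hmodel.measurable i

theorem integrable_length_keyComparisons [IsFiniteMeasure P]
    (hmodel : IsPoissonKeyModel μ X N P) (φ : ℕ → ℝ) (l : List ℕ) :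
    Integrable (fun ω => φ (keyComparisons (l.map (fun i => toLex (X i ω)))).length) P := by
  obtain ⟨C, hC⟩ : ∃ C, ∀ k ≤ l.length ^ 2, ‖φ k‖ ≤ C := by
    refine ⟨∑ k ∈ Finset.range (l.length ^ 2 + 1), ‖φ k‖, fun k hk => ?_⟩
    exact Finset.single_le_sum (f := fun k => ‖φ k‖) (fun _ _ => norm_nonneg _)
      (Finset.mem_range.2 (by omega))
  refine Integrable.of_bound (C := C) ?_ (ae_of_all _ fun ω => hC _ ?_)
  · exact ((Measurable.of_discrete (f := φ)).comp ((measurable_length_map l).comp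
      (measurable_keys hmodel))).aestronglyMeasurable
  · exact length_keyComparisons_le _ _ (by simp)

theorem integral_permAvg {ι : Type*} [DecidableEq ι] (n : ℕ) (s : Finset ι)
    (G : List ι → Ω → ℝ) (hG : ∀ l, Integrable (G l) P) :
    Integrable (fun ω => permAvg n s (fun l => G l ω)) P ∧
      ∫ ω, permAvg n s (fun l => G l ω) ∂P = permAvg n s (fun l => ∫ ω, G l ω ∂P) := by
  induction n generalizing s G with
  | zero => exact ⟨hG [], rfl⟩
  | succ n ih =>
    have h := fun a => ih (s.erase a) (fun l => G (a :: l)) fun l => hG _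
    simp only [permAvg]
    refine ⟨(integrable_finsetSum _ fun a _ => (h a).1).div_const _, ?_⟩
    rw [integral_div, integral_finsetSum _ fun a _ => (h a).1]
    simp only [(h _).2]

/-- By exchangeability every ordering of the first `n` keys gives the same expectation. The averaged
integrand can then be evaluated pointwise, for fixed distinct keys. -/
theorem integral_keyCount_eq_permAvg [IsProbabilityMeasure P]
    (hmodel : IsPoissonKeyModel μ X N P) (φ : ℕ → ℝ) (n : ℕ) :
    ∫ ω, φ (keyCount (fun i => X i ω) n) ∂P = ∫ ω, permAvg n (Finset.range n) (fun l =>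
      φ (keyComparisons (l.map (fun i => toLex (X i ω)))).length) ∂P := by
  rw [(integral_permAvg n (Finset.range n) _
    (integrable_length_keyComparisons hmodel φ)).2]
  rw [permAvg_congr (G' := fun _ => ∫ ω, φ (keyCount (fun i => X i ω) n) ∂P)
    (Finset.card_range n), permAvg_const (Finset.card_range n)]
  intro l hl hnd _
  have h := integral_length_keyComparisons_congr hmodel φ (List.nodup_range (n := n))
  rw [List.length_range] at h
  simp only [keyCount, comparisons, List.length_map]
  rw [h, integral_length_keyComparisons_congr hmodel φ hnd]
  subst hl
  rfl

theorem integral_keyCount [IsProbabilityMeasure P] [IsProbabilityMeasure μ]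
    (hmodel : IsPoissonKeyModel μ X N P)
    (hsum : Summable fun k : ℕ => √(coincidence μ k)) (n : ℕ) :
    ∫ ω, (keyCount (fun i => X i ω) n : ℝ) ∂P = meanKey n ∧
    ∫ ω, (keyCount (fun i => X i ω) n : ℝ) ^ 2 ∂P = sqKey n := by
  have hmom := (ae_injective_keys hmodel hsum).mono fun ω hω =>
    permAvg_moments (m := meanKey) (b := sqKey) (by simp [meanKey, harm_zero])
      (by simp [sqKey, varKey, meanKey, harm_zero, harmSq_zero]) meanKey_succ sqKey_succ n
      (Finset.range n) (fun i => toLex (X i ω)) (toLex.injective.comp hω).injOn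
      (Finset.card_range n)
  constructor
  · rw [integral_keyCount_eq_permAvg hmodel (fun k => (k : ℝ)),
      integral_congr_ae (hmom.mono fun ω h => h.1)]
    simp
  · rw [integral_keyCount_eq_permAvg hmodel (fun k => (k : ℝ) ^ 2),
      integral_congr_ae (hmom.mono fun ω h => h.2)]
    simp

/-- The variance is the least mean square deviation. The centre `c` is free because it will be the
mean of `K(t)`, not that of `K_n`. -/
theorem varKey_le_lintegral [IsProbabilityMeasure P] [IsProbabilityMeasure μ]
    (hmodel : IsPoissonKeyModel μ X N P)
    (hsum : Summable fun k : ℕ => √(coincidence μ k)) (n : ℕ) (c : ℝ) :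
    ENNReal.ofReal (varKey n) ≤
      ∫⁻ ω, ENNReal.ofReal (((keyCount (fun i => X i ω) n : ℝ) - c) ^ 2) ∂P := by
  obtain ⟨h1, h2⟩ := integral_keyCount hmodel hsum n
  have hint : ∀ φ : ℕ → ℝ, Integrable (fun ω => φ (keyCount (fun i => X i ω) n)) P := by
    intro φ
    simpa [keyCount, comparisons] using integrable_length_keyComparisons hmodel φ (List.range n)
  rw [← ofReal_integral_eq_lintegral_ofReal (hint fun k => ((k : ℝ) - c) ^ 2)
    (ae_of_all _ fun ω => sq_nonneg _)]
  refine ENNReal.ofReal_le_ofReal ?_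
  have e : ∀ k : ℝ, (k - c) ^ 2 = k ^ 2 - 2 * c * k + c ^ 2 := fun k => by ring
  simp only [e]
  have hadd := integral_add ((hint fun k => (k : ℝ) ^ 2).sub ((hint fun k => (k : ℝ)).const_mul
    (2 * c))) (integrable_const (c ^ 2))
  simp only [Pi.sub_apply] at hadd
  rw [hadd, integral_sub (hint fun k => (k : ℝ) ^ 2)
    ((hint fun k => (k : ℝ)).const_mul _), integral_const_mul, h1, h2]
  simp only [integral_const, probReal_univ, one_smul, sqKey]
  nlinarith [sq_nonneg (meanKey n - c)]

theorem hasLaw_arrivals [IsProbabilityMeasure P] (hmodel : IsPoissonKeyModel μ X N P) (t : ℝ≥0) :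
    P.map (N t) = poissonMeasure t := by
  have h := (hmodel.poisson.incrementLaw 0 t (zero_le)).map_eq
  rw [tsub_zero] at h
  rw [← h]
  refine Measure.map_congr ?_
  filter_upwards [hmodel.poisson.start] with ω hω
  simp [hω]

theorem lintegral_arrivals [IsProbabilityMeasure P] (hmodel : IsPoissonKeyModel μ X N P) (t : ℝ≥0)
    (F : ℕ → (ℕ → ℕ → α) → ℝ≥0∞) (hF : ∀ n, Measurable (F n)) :
    ∫⁻ ω, F (N t ω) (fun i => X i ω) ∂P =
      ∫⁻ n, ∫⁻ ω, F n (fun i => X i ω) ∂P ∂(poissonMeasure t) := by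
  have hN := hmodel.poisson.measurable t
  have hX := measurable_keys hmodel
  have hind : IndepFun (N t) (fun ω i => X i ω) P :=
    (hmodel.indepArrivals.comp measurable_id (measurable_pi_apply t)).symm
  have hprod := (indepFun_iff_map_prod_eq_prod_map_map hN.aemeasurable hX.aemeasurable).1 hind
  have hF' : Measurable fun z : ℕ × (ℕ → ℕ → α) => F z.1 z.2 :=
    measurable_from_prod_countable_right hF
  have : IsProbabilityMeasure (P.map fun ω i => X i ω) :=
    Measure.isProbabilityMeasure_map hX.aemeasurable
  have e1 := lintegral_map (μ := P) hF' (hN.prodMk hX)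
  rw [← e1, hprod, lintegral_prod _ hF'.aemeasurable, hasLaw_arrivals hmodel]
  congr with n
  rw [lintegral_map (hF n) hX]

theorem measurable_comp_arrivals (hmodel : IsPoissonKeyModel μ X N P) (t : ℝ≥0)
    {γ : Type*} [MeasurableSpace γ]
    {F : ℕ → (ℕ → ℕ → α) → γ} (hF : ∀ n, Measurable (F n)) :
    Measurable fun ω => F (N t ω) (fun i => X i ω) := by
  have hF' : Measurable fun z : ℕ × (ℕ → ℕ → α) => F z.1 z.2 :=
    measurable_from_prod_countable_right hF
  exact hF'.comp ((hmodel.poisson.measurable t).prodMk (measurable_keys hmodel))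

/-- The square is at most `n⁴`, and it vanishes unless one of at most `n²` pairs of keys agrees in
`k` symbols. -/
theorem lintegral_levelCount_sq_le [IsProbabilityMeasure P] [IsProbabilityMeasure μ]
    (hmodel : IsPoissonKeyModel μ X N P) (k n : ℕ) :
    ∫⁻ ω, (levelCount k (fun i => X i ω) n : ℝ≥0∞) ^ 2 ∂P ≤
      (n : ℝ≥0∞) ^ 6 * ENNReal.ofReal (coincidence μ k) := by
  classical
  set A : ℕ × ℕ → Set Ω := fun p => {ω | ComparesSymbol k (X p.2 ω) (X p.1 ω)} with hA
  have hAm : ∀ p, MeasurableSet (A p) := fun p =>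
    ((hmodel.measurable p.2).prodMk (hmodel.measurable p.1)) (measurableSet_comparesSymbol k)
  set T := (Finset.range n ×ˢ Finset.range n).filter (fun p : ℕ × ℕ => p.1 < p.2) with hT
  have hTc : T.card ≤ n ^ 2 := (Finset.card_filter_le _ _).trans (by simp [sq])
  have hle : ∀ ω, (levelCount k (fun i => X i ω) n : ℝ≥0∞) ^ 2 ≤
      (n : ℝ≥0∞) ^ 4 * ∑ p ∈ T, (A p).indicator 1 ω := by
    intro ω
    by_cases h : ∃ p ∈ T, ω ∈ A p
    · obtain ⟨p, hp, hω⟩ := h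
      have h1 : (1 : ℝ≥0∞) ≤ ∑ p ∈ T, (A p).indicator 1 ω := by
        refine le_trans ?_ (Finset.single_le_sum (f := fun p => (A p).indicator (1 : Ω → ℝ≥0∞) ω)
          (fun _ _ => zero_le) hp)
        simp [hω]
      calc (levelCount k (fun i => X i ω) n : ℝ≥0∞) ^ 2 ≤ ((n : ℝ≥0∞) ^ 2) ^ 2 := by
            gcongr
            exact_mod_cast levelCount_le k _ n
        _ = (n : ℝ≥0∞) ^ 4 * 1 := by ring
        _ ≤ _ := by gcongr
    · push Not at h
      rw [levelCount_eq_zero]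
      · simp
      · intro i j hij hj hc
        exact h (i, j) (by simp [hT, hij, hj, hij.trans hj]) hc
  calc ∫⁻ ω, (levelCount k (fun i => X i ω) n : ℝ≥0∞) ^ 2 ∂P
      ≤ ∫⁻ ω, (n : ℝ≥0∞) ^ 4 * ∑ p ∈ T, (A p).indicator 1 ω ∂P := lintegral_mono hle
    _ = (n : ℝ≥0∞) ^ 4 * ∑ p ∈ T, P (A p) := by
        rw [lintegral_const_mul' _ _ (by simp), lintegral_finsetSum' _ fun p _ =>
          (measurable_one.indicator (hAm p)).aemeasurable]
        simp only [lintegral_indicator_one (hAm _)]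
    _ ≤ (n : ℝ≥0∞) ^ 4 * ((n : ℝ≥0∞) ^ 2 * ENNReal.ofReal (coincidence μ k)) := by
        gcongr
        calc ∑ p ∈ T, P (A p) ≤ T.card • ENNReal.ofReal (coincidence μ k) := by
              refine Finset.sum_le_card_nsmul _ _ _ fun p hp => ?_
              exact measure_comparesSymbol_le hmodel k (Finset.mem_filter.1 hp).2.ne'
          _ ≤ _ := by
              rw [nsmul_eq_mul]
              gcongr
              exact_mod_cast hTc
    _ = _ := by ring

end Keys

/-! ### Variance inequalities and `L²` limits -/

section Variance

variable {Ω : Type*} [MeasurableSpace Ω] {P : Measure Ω}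

theorem eLpNorm_two_sq {ε : Type*} [ENorm ε] (f : Ω → ε) :
    eLpNorm f 2 P ^ 2 = ∫⁻ ω, ‖f ω‖ₑ ^ 2 ∂P := by
  have h := eLpNorm_nnreal_pow_eq_lintegral (f := f) (μ := P) (p := 2) two_ne_zero
  simpa only [NNReal.coe_ofNat, ENNReal.coe_ofNat, ENNReal.rpow_two] using h

/-- Expanding `Var (δ U - V) ≥ 0` bounds `2 Cov(U, V)` by `δ Var U + Var V / δ`. -/
theorem variance_add_le [IsFiniteMeasure P] {U V : Ω → ℝ} (hU : MemLp U 2 P) (hV : MemLp V 2 P)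
    {δ : ℝ} (hδ : 0 < δ) :
    Var[U + V; P] ≤ (1 + δ) * Var[U; P] + (1 + 1 / δ) * Var[V; P] := by
  have h0 : 0 ≤ Var[δ • U - V; P] := variance_nonneg _ _
  rw [variance_sub (hU.const_smul δ) hV, variance_smul, covariance_smul_left] at h0
  rw [variance_add hU hV]
  have h1 : 0 ≤ (1 / δ) * (δ ^ 2 * Var[U; P] - 2 * (δ * cov[U, V; P]) + Var[V; P]) :=
    mul_nonneg (by positivity) h0
  have h2 : (1 / δ) * (δ ^ 2 * Var[U; P] - 2 * (δ * cov[U, V; P]) + Var[V; P]) =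
      δ * Var[U; P] - 2 * cov[U, V; P] + 1 / δ * Var[V; P] := by
    field_simp
  rw [h2] at h1
  linarith

/-- Asymptotic lower bounds of variances pass to limits in `L²`. -/
theorem le_variance_of_tendsto_eLpNorm [IsProbabilityMeasure P] {ι : Type*} {l : Filter ι}
    [l.NeBot] {F : ι → Ω → ℝ} {Y : Ω → ℝ} (hF : ∀ᶠ i in l, MemLp (F i) 2 P)
    (hY : AEStronglyMeasurable Y P)
    (hlim : Tendsto (fun i => eLpNorm (fun ω => F i ω - Y ω) 2 P) l (𝓝 0)) {s : ℝ}
    (hs : ∀ ε > 0, ∀ᶠ i in l, s - ε ≤ Var[F i; P]) :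
    MemLp Y 2 P ∧ s ≤ Var[Y; P] := by
  have hfin : ∀ᶠ i in l, eLpNorm (fun ω => F i ω - Y ω) 2 P < ∞ :=
    hlim.eventually_lt_const (by simp)
  have hYm : MemLp Y 2 P := by
    obtain ⟨i, hi, hi'⟩ := (hF.and hfin).exists
    have hD : MemLp (fun ω => F i ω - Y ω) 2 P := ⟨hi.1.sub hY, hi'⟩
    have h := hi.sub hD
    rwa [show F i - (fun ω => F i ω - Y ω) = Y by funext ω; simp] at h
  refine ⟨hYm, ?_⟩
  have hvar : Tendsto (fun i => Var[F i - Y; P]) l (𝓝 0) := by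
    have h1 : Tendsto (fun i => (eLpNorm (fun ω => F i ω - Y ω) 2 P ^ 2).toReal) l (𝓝 0) := by
      have h2 := ENNReal.Tendsto.pow (n := 2) hlim
      have h3 := (ENNReal.tendsto_toReal (by simp)).comp h2
      simpa [Function.comp_def] using h3
    refine squeeze_zero' (Eventually.of_forall fun i => variance_nonneg _ _) ?_ h1
    filter_upwards [hF, hfin] with i hi hi'
    have hD : MemLp (F i - Y) 2 P := hi.sub hYm
    refine (variance_le_expectation_sq hD.1).trans ?_
    simp only [Pi.pow_apply]
    rw [eLpNorm_two_sq, integral_eq_lintegral_of_nonneg_ae (ae_of_all _ fun ω => sq_nonneg _)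
      (hD.1.pow 2)]
    refine le_of_eq (congrArg _ (lintegral_congr fun ω => ?_))
    rw [Real.enorm_eq_ofReal_abs, ← ENNReal.ofReal_pow (abs_nonneg _), sq_abs]
    rfl
  -- Write `F i = Y + (F i - Y)`, where the variance of the second term tends to zero along `l`;
  -- only afterwards does `δ` tend to zero.
  have hδ : ∀ δ > 0, s - δ ≤ (1 + δ) * Var[Y; P] := by
    intro δ hδ
    have h1 : Tendsto (fun i => (1 + δ) * Var[Y; P] + (1 + 1 / δ) * Var[F i - Y; P]) l
        (𝓝 ((1 + δ) * Var[Y; P] + (1 + 1 / δ) * 0)) := (hvar.const_mul _).const_add _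
    rw [mul_zero, add_zero] at h1
    refine ge_of_tendsto h1 ?_
    filter_upwards [hs δ hδ, hF] with i hi hi'
    refine hi.trans ?_
    have := variance_add_le hYm (hi'.sub hYm) hδ
    rwa [add_sub_cancel] at this
  have h1 : Tendsto (fun δ : ℝ => s - δ) (𝓝[>] 0) (𝓝 (s - 0)) :=
    (tendsto_id.const_sub s).mono_left nhdsWithin_le_nhds
  have h2 : Tendsto (fun δ : ℝ => (1 + δ) * Var[Y; P]) (𝓝[>] 0) (𝓝 ((1 + 0) * Var[Y; P])) :=
    ((tendsto_id.const_add 1).mul_const _).mono_left nhdsWithin_le_nhds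
  simpa using le_of_tendsto_of_tendsto h1 h2
    (eventually_nhdsWithin_of_forall fun δ hd => hδ δ hd)

theorem variance_sub_const_div [IsProbabilityMeasure P] {U : Ω → ℝ}
    (hU : AEStronglyMeasurable U P) (c r : ℝ) :
    Var[fun ω => (U ω - c) / r; P] = (r ^ 2)⁻¹ * Var[U; P] := by
  simp only [div_eq_inv_mul]
  rw [variance_const_mul, variance_sub_const hU, inv_pow]

end Variance

/-! ### Square integrability and variance bounds at a fixed time -/

section Model

variable {α : Type*} [Fintype α] [LinearOrder α] [MeasurableSpace α] [MeasurableSingletonClass α]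
  {Ω : Type*} [MeasurableSpace Ω] {P : Measure Ω} [IsProbabilityMeasure P]
  {μ : Measure (ℕ → α)} [IsProbabilityMeasure μ]
  {X : ℕ → Ω → ℕ → α} {N : ℝ≥0 → Ω → ℕ}

theorem measurable_levelCountAt (hmodel : IsPoissonKeyModel μ X N P) (k : ℕ) (t : ℝ≥0) :
    Measurable (levelCountAt X N k t) :=
  (Measurable.of_discrete (f := fun n : ℕ => (n : ℝ))).comp
    (measurable_comp_arrivals hmodel t fun n => measurable_levelCount k n)

theorem measurable_prefixCountAt (hmodel : IsPoissonKeyModel μ X N P) {k : ℕ} (w : Fin k → α)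
    (t : ℝ≥0) : Measurable (prefixCountAt X N w t) :=
  (Measurable.of_discrete (f := fun n : ℕ => (n : ℝ))).comp
    (measurable_comp_arrivals hmodel t fun n => measurable_prefixCount w n)

/-- The constant is the square root of the sixth moment of `N(t)`. Being independent of `k`, it
leaves exactly the summable series of the hypothesis. -/
theorem exists_eLpNorm_levelCountAt_le (hmodel : IsPoissonKeyModel μ X N P) (t : ℝ≥0) :
    ∃ C : ℝ≥0∞, C ≠ ∞ ∧ ∀ k, eLpNorm (levelCountAt X N k t) 2 P ≤
      C * ENNReal.ofReal √(coincidence μ k) := by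
  set M := ∫⁻ n : ℕ, (n : ℝ≥0∞) ^ 6 ∂(poissonMeasure t) with hM
  have hMt : M ≠ ∞ := (lintegral_pow_poissonMeasure_lt_top t 6).ne
  refine ⟨M ^ (1 / 2 : ℝ), ENNReal.rpow_ne_top_of_nonneg (by norm_num) hMt, fun k => ?_⟩
  rw [← ENNReal.pow_le_pow_left_iff two_ne_zero, eLpNorm_two_sq, mul_pow,
    ← ENNReal.ofReal_pow (Real.sqrt_nonneg _), Real.sq_sqrt (coincidence_nonneg μ k),
    ← ENNReal.rpow_natCast, ← ENNReal.rpow_mul]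
  norm_num
  calc ∫⁻ ω, ‖levelCountAt X N k t ω‖ₑ ^ 2 ∂P
      = ∫⁻ ω, (levelCount k (fun i => X i ω) (N t ω) : ℝ≥0∞) ^ 2 ∂P := by
        simp [levelCountAt]
    _ = ∫⁻ n, ∫⁻ ω, (levelCount k (fun i => X i ω) n : ℝ≥0∞) ^ 2 ∂P ∂(poissonMeasure t) :=
        lintegral_arrivals hmodel t (fun n x => (levelCount k x n : ℝ≥0∞) ^ 2) fun n =>
          (Measurable.of_discrete (f := fun m : ℕ => (m : ℝ≥0∞) ^ 2)).comp
            (measurable_levelCount k n)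
    _ ≤ ∫⁻ n : ℕ, (n : ℝ≥0∞) ^ 6 * ENNReal.ofReal (coincidence μ k) ∂(poissonMeasure t) :=
        lintegral_mono fun n => lintegral_levelCount_sq_le hmodel k n
    _ = M * ENNReal.ofReal (coincidence μ k) := lintegral_mul_const _ .of_discrete

theorem memLp_levelCountAt (hmodel : IsPoissonKeyModel μ X N P) (k : ℕ) (t : ℝ≥0) :
    MemLp (levelCountAt X N k t) 2 P := by
  obtain ⟨C, hC, h⟩ := exists_eLpNorm_levelCountAt_le hmodel t
  exact ⟨(measurable_levelCountAt hmodel k t).aestronglyMeasurable,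
    (h k).trans_lt (ENNReal.mul_lt_top hC.lt_top ENNReal.ofReal_lt_top)⟩

theorem levelCountAt_eq_sum (k : ℕ) (t : ℝ≥0) :
    levelCountAt X N k t = ∑ w : Fin k → α, prefixCountAt X N w t := by
  funext ω
  simp [levelCountAt, prefixCountAt, levelCount_eq_sum_prefixCount]

theorem memLp_prefixCountAt (hmodel : IsPoissonKeyModel μ X N P) {k : ℕ} (w : Fin k → α)
    (t : ℝ≥0) : MemLp (prefixCountAt X N w t) 2 P := by
  refine (memLp_levelCountAt hmodel k t).mono
    (measurable_prefixCountAt hmodel w t).aestronglyMeasurable (ae_of_all _ fun ω => ?_)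
  rw [levelCountAt_eq_sum, Finset.sum_apply]
  have h0 : ∀ v : Fin k → α, 0 ≤ prefixCountAt X N v t ω := fun v => Nat.cast_nonneg _
  rw [Real.norm_of_nonneg (h0 w), Real.norm_of_nonneg (Finset.sum_nonneg fun v _ => h0 v)]
  exact Finset.single_le_sum (f := fun v => prefixCountAt X N v t ω) (fun v _ => h0 v)
    (Finset.mem_univ w)

theorem covariance_levelCountAt_nonneg (hmodel : IsPoissonKeyModel μ X N P) {t : ℝ≥0}
    (hcorr : ∀ (j k : ℕ) (v : Fin j → α) (w : Fin k → α),
      0 ≤ cov[prefixCountAt X N v t, prefixCountAt X N w t; P]) (j k : ℕ) :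
    0 ≤ cov[levelCountAt X N j t, levelCountAt X N k t; P] := by
  rw [levelCountAt_eq_sum, levelCountAt_eq_sum, covariance_sum_sum
    (fun v => memLp_prefixCountAt hmodel v t) (fun w => memLp_prefixCountAt hmodel w t)]
  exact Finset.sum_nonneg fun v _ => Finset.sum_nonneg fun w _ => hcorr j k v w

theorem variance_le_variance_sum_levelCountAt (hmodel : IsPoissonKeyModel μ X N P) {t : ℝ≥0}
    (hcorr : ∀ (j k : ℕ) (v : Fin j → α) (w : Fin k → α),
      0 ≤ cov[prefixCountAt X N v t, prefixCountAt X N w t; P]) (m : ℕ) :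
    Var[levelCountAt X N 0 t; P] ≤ Var[∑ k ∈ Finset.range (m + 1), levelCountAt X N k t; P] := by
  have hL := fun k => memLp_levelCountAt hmodel k t
  have hR : MemLp (∑ k ∈ Finset.range m, levelCountAt X N (k + 1) t) 2 P :=
    memLp_finsetSum' _ fun k _ => hL _
  rw [Finset.sum_range_succ', add_comm, variance_add (hL 0) hR,
    covariance_sum_right' (fun k _ => hL _) (hL 0)]
  have h1 := variance_nonneg (∑ k ∈ Finset.range m, levelCountAt X N (k + 1) t) P
  have h2 : 0 ≤ ∑ k ∈ Finset.range m, cov[levelCountAt X N 0 t, levelCountAt X N (k + 1) t; P] :=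
    Finset.sum_nonneg fun k _ => covariance_levelCountAt_nonneg hmodel hcorr _ _
  linarith

/-- Minkowski's inequality bounds the partial sums uniformly in `L²`, and monotone convergence
passes to the total. Almost sure finiteness is a consequence, not an input. -/
theorem lintegral_symbolCountAt_sq_lt_top (hmodel : IsPoissonKeyModel μ X N P)
    (hsum : Summable fun k : ℕ => √(coincidence μ k)) (t : ℝ≥0) :
    ∫⁻ ω, ((symbolCountAt X N t ω : ℕ∞) : ℝ≥0∞) ^ 2 ∂P < ∞ := by
  obtain ⟨C, hC, hle⟩ := exists_eLpNorm_levelCountAt_le hmodel t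
  set B := ∑' k, C * ENNReal.ofReal √(coincidence μ k) with hB
  have hBt : B ≠ ∞ := by
    rw [hB, ENNReal.tsum_mul_left]
    refine ENNReal.mul_ne_top hC ?_
    rw [← ENNReal.ofReal_tsum_of_nonneg (fun k => Real.sqrt_nonneg _) hsum]
    exact ENNReal.ofReal_ne_top
  have hmeas : ∀ k, Measurable fun ω => (levelCount k (fun i => X i ω) (N t ω) : ℝ≥0∞) :=
    fun k => (Measurable.of_discrete (f := fun n : ℕ => (n : ℝ≥0∞))).comp
      (measurable_comp_arrivals hmodel t fun n => measurable_levelCount k n)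
  have hpart : ∀ m : ℕ, ∫⁻ ω, (∑ k ∈ Finset.range m,
      (levelCount k (fun i => X i ω) (N t ω) : ℝ≥0∞)) ^ 2 ∂P ≤ B ^ 2 := by
    intro m
    calc ∫⁻ ω, (∑ k ∈ Finset.range m, (levelCount k (fun i => X i ω) (N t ω) : ℝ≥0∞)) ^ 2 ∂P
        = eLpNorm (∑ k ∈ Finset.range m, levelCountAt X N k t) 2 P ^ 2 := by
          rw [eLpNorm_two_sq]
          refine lintegral_congr fun ω => ?_
          rw [Finset.sum_apply]
          simp only [levelCountAt]
          rw [← Nat.cast_sum, ← Nat.cast_sum, Real.enorm_natCast]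
      _ ≤ B ^ 2 := by
          gcongr
          refine (eLpNorm_sum_le (fun k _ =>
            (measurable_levelCountAt hmodel k t).aestronglyMeasurable) one_le_two).trans ?_
          exact (Finset.sum_le_sum fun k _ => hle k).trans (ENNReal.sum_le_tsum _)
  have htend := lintegral_tendsto_of_tendsto_of_monotone (μ := P)
    (f := fun m ω => (∑ k ∈ Finset.range m,
      (levelCount k (fun i => X i ω) (N t ω) : ℝ≥0∞)) ^ 2)
    (F := fun ω => ((symbolCountAt X N t ω : ℕ∞) : ℝ≥0∞) ^ 2)
    (fun m => ((Finset.measurable_sum _ fun k _ => hmeas k).pow_const 2).aemeasurable)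
    (ae_of_all _ fun ω m m' hm => by
      dsimp only
      gcongr)
    (ae_of_all _ fun ω => by
      rw [symbolCountAt, toENNReal_symbolCount]
      exact ENNReal.Tendsto.pow (ENNReal.tendsto_nat_tsum _))
  exact (le_of_tendsto' htend hpart).trans_lt (ENNReal.pow_lt_top hBt.lt_top)

theorem measurable_toENNReal_symbolCountAt (hmodel : IsPoissonKeyModel μ X N P) (t : ℝ≥0) :
    Measurable fun ω => ((symbolCountAt X N t ω : ℕ∞) : ℝ≥0∞) := by
  simp only [symbolCountAt, toENNReal_symbolCount]
  exact Measurable.tsum fun k =>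
    (Measurable.of_discrete (f := fun n : ℕ => (n : ℝ≥0∞))).comp
      (measurable_comp_arrivals hmodel t fun n => measurable_levelCount k n)

theorem ae_symbolCountAt_ne_top (hmodel : IsPoissonKeyModel μ X N P)
    (hsum : Summable fun k : ℕ => √(coincidence μ k)) (t : ℝ≥0) :
    ∀ᵐ ω ∂P, symbolCountAt X N t ω ≠ ⊤ := by
  filter_upwards [ae_lt_top ((measurable_toENNReal_symbolCountAt hmodel t).pow_const 2)
    (lintegral_symbolCountAt_sq_lt_top hmodel hsum t).ne] with ω hω
  intro h
  simp [h] at hω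

theorem realSymbolCountAt_eq_toReal (t : ℝ≥0) (ω : Ω) :
    realSymbolCountAt X N t ω = ((symbolCountAt X N t ω : ℕ∞) : ℝ≥0∞).toReal := by
  rw [realSymbolCountAt]
  cases symbolCountAt X N t ω <;> simp

theorem memLp_realSymbolCountAt (hmodel : IsPoissonKeyModel μ X N P)
    (hsum : Summable fun k : ℕ => √(coincidence μ k)) (t : ℝ≥0) :
    MemLp (realSymbolCountAt X N t) 2 P := by
  have hm : Measurable (realSymbolCountAt X N t) := by
    have := (measurable_toENNReal_symbolCountAt hmodel t).ennreal_toReal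
    simpa only [← realSymbolCountAt_eq_toReal] using this
  refine ⟨hm.aestronglyMeasurable, ?_⟩
  have h2 : eLpNorm (realSymbolCountAt X N t) 2 P ^ 2 < ∞ := by
    rw [eLpNorm_two_sq]
    refine (lintegral_mono fun ω => ?_).trans_lt (lintegral_symbolCountAt_sq_lt_top hmodel hsum t)
    gcongr
    rw [realSymbolCountAt_eq_toReal, Real.enorm_of_nonneg ENNReal.toReal_nonneg]
    exact ENNReal.ofReal_toReal_le
  by_contra h
  rw [not_lt, top_le_iff] at h
  simp [h] at h2

theorem hasSum_levelCountAt (hmodel : IsPoissonKeyModel μ X N P)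
    (hsum : Summable fun k : ℕ => √(coincidence μ k)) (t : ℝ≥0) :
    ∀ᵐ ω ∂P, HasSum (fun k => levelCountAt X N k t ω) (realSymbolCountAt X N t ω) := by
  filter_upwards [ae_symbolCountAt_ne_top hmodel hsum t] with ω hω
  have h1 : ∑' k, (levelCount k (fun i => X i ω) (N t ω) : ℝ≥0∞) ≠ ∞ := by
    rw [← toENNReal_symbolCount, ne_eq, ENat.toENNReal_eq_top]
    exact hω
  have h2 := ENNReal.hasSum_toReal h1
  rw [realSymbolCountAt_eq_toReal, symbolCountAt, toENNReal_symbolCount,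
    ENNReal.tsum_toReal_eq (fun k => by simp)]
  simpa [levelCountAt] using h2

/-- The partial sums increase almost surely to `S(t)`, which dominates them and lies in `L²`. Hence
their means, second moments and variances converge. -/
theorem variance_levelCountAt_zero_le (hmodel : IsPoissonKeyModel μ X N P)
    (hsum : Summable fun k : ℕ => √(coincidence μ k)) {t : ℝ≥0}
    (hcorr : ∀ (j k : ℕ) (v : Fin j → α) (w : Fin k → α),
      0 ≤ cov[prefixCountAt X N v t, prefixCountAt X N w t; P]) :
    Var[levelCountAt X N 0 t; P] ≤ Var[realSymbolCountAt X N t; P] := by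
  have hS := memLp_realSymbolCountAt hmodel hsum t
  have hT : ∀ m, MemLp (∑ k ∈ Finset.range m, levelCountAt X N k t) 2 P := fun m =>
    memLp_finsetSum' _ fun k _ => memLp_levelCountAt hmodel k t
  have hae := hasSum_levelCountAt hmodel hsum t
  have h0 : ∀ k ω, 0 ≤ levelCountAt X N k t ω := fun k ω => Nat.cast_nonneg _
  have hT0 : ∀ m ω, 0 ≤ (∑ k ∈ Finset.range m, levelCountAt X N k t) ω := fun m ω => by
    rw [Finset.sum_apply]
    exact Finset.sum_nonneg fun k _ => h0 k ω
  have hTle : ∀ m, ∀ᵐ ω ∂P, (∑ k ∈ Finset.range m, levelCountAt X N k t) ω ≤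
      realSymbolCountAt X N t ω := fun m => by
    filter_upwards [hae] with ω hω
    rw [Finset.sum_apply]
    exact sum_le_hasSum _ (fun k _ => h0 k ω) hω
  have hTt : ∀ᵐ ω ∂P, Tendsto (fun m => (∑ k ∈ Finset.range m, levelCountAt X N k t) ω) atTop
      (𝓝 (realSymbolCountAt X N t ω)) := by
    filter_upwards [hae] with ω hω
    simpa only [Finset.sum_apply] using hω.tendsto_sum_nat
  have hm1 : Tendsto (fun m => ∫ ω, (∑ k ∈ Finset.range m, levelCountAt X N k t) ω ∂P) atTop
      (𝓝 (∫ ω, realSymbolCountAt X N t ω ∂P)) := by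
    refine tendsto_integral_of_dominated_convergence (realSymbolCountAt X N t)
      (fun m => (hT m).1) (hS.integrable one_le_two) (fun m => ?_) hTt
    filter_upwards [hTle m] with ω hω
    rwa [Real.norm_of_nonneg (hT0 m ω)]
  have hm2 : Tendsto (fun m => ∫ ω, ((∑ k ∈ Finset.range m, levelCountAt X N k t) ^ 2) ω ∂P) atTop
      (𝓝 (∫ ω, (realSymbolCountAt X N t ^ 2) ω ∂P)) := by
    refine tendsto_integral_of_dominated_convergence (realSymbolCountAt X N t ^ 2)
      (fun m => (hT m).1.pow 2) hS.integrable_sq (fun m => ?_) ?_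
    · filter_upwards [hTle m] with ω hω
      simp only [Pi.pow_apply]
      rw [Real.norm_of_nonneg (sq_nonneg _)]
      exact pow_le_pow_left₀ (hT0 m ω) hω 2
    · filter_upwards [hTt] with ω hω
      exact hω.pow 2
  have hvar : Tendsto (fun m => Var[∑ k ∈ Finset.range m, levelCountAt X N k t; P]) atTop
      (𝓝 Var[realSymbolCountAt X N t; P]) := by
    rw [variance_eq_sub hS]
    simp only [variance_eq_sub (hT _)]
    exact hm2.sub (hm1.pow 2)
  exact ge_of_tendsto' ((tendsto_add_atTop_iff_nat 1).2 hvar)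
    (variance_le_variance_sum_levelCountAt hmodel hcorr)

theorem levelCountAt_zero (t : ℝ≥0) : levelCountAt X N 0 t = keyCountAt X N t := by
  funext ω
  simp [levelCountAt, keyCountAt, levelCount_zero]

/-- Given `N(t) = n`, the mean square deviation of `K_n` from the overall mean is at least `varKey
n`; average this over the Poisson law and use `E N(t)² ≥ t²`. -/
theorem le_variance_keyCountAt (hmodel : IsPoissonKeyModel μ X N P)
    (hsum : Summable fun k : ℕ => √(coincidence μ k)) {a C : ℝ} (ha : 0 ≤ a)
    (hv : ∀ n : ℕ, a * n ^ 2 - C ≤ varKey n) (t : ℝ≥0) :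
    a * (t : ℝ) ^ 2 - C ≤ Var[keyCountAt X N t; P] := by
  have hK : MemLp (keyCountAt X N t) 2 P := by
    rw [← levelCountAt_zero]
    exact memLp_levelCountAt hmodel 0 t
  set c := ∫ ω, keyCountAt X N t ω ∂P with hc
  have hint := integrable_pow_poissonMeasure t 2
  have hg : Integrable (fun n : ℕ => a * (n : ℝ) ^ 2 - C) (poissonMeasure t) :=
    (hint.const_mul a).sub (integrable_const C)
  -- The lower bound may be negative for small `n`, so its positive part is used to enter the `[0,
  -- ∞]`-valued integral.
  have hg' : Integrable (fun n : ℕ => max (a * (n : ℝ) ^ 2 - C) 0) (poissonMeasure t) :=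
    hg.pos_part
  have h1 : ENNReal.ofReal (∫ n : ℕ, (a * (n : ℝ) ^ 2 - C) ∂(poissonMeasure t)) ≤
      ENNReal.ofReal Var[keyCountAt X N t; P] := by
    calc ENNReal.ofReal (∫ n : ℕ, (a * (n : ℝ) ^ 2 - C) ∂(poissonMeasure t))
        ≤ ENNReal.ofReal (∫ n : ℕ, max (a * (n : ℝ) ^ 2 - C) 0 ∂(poissonMeasure t)) := by
          exact ENNReal.ofReal_le_ofReal (integral_mono hg hg' fun n => le_max_left _ _)
      _ = ∫⁻ n : ℕ, ENNReal.ofReal (max (a * (n : ℝ) ^ 2 - C) 0) ∂(poissonMeasure t) :=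
          ofReal_integral_eq_lintegral_ofReal hg' (ae_of_all _ fun n => le_max_right _ _)
      _ ≤ ∫⁻ n : ℕ, ∫⁻ ω, ENNReal.ofReal (((keyCount (fun i => X i ω) n : ℝ) - c) ^ 2) ∂P
            ∂(poissonMeasure t) := by
          refine lintegral_mono fun n => ?_
          refine le_trans ?_ (varKey_le_lintegral hmodel hsum n c)
          rcases le_total (a * (n : ℝ) ^ 2 - C) 0 with h | h
          · simp [max_eq_right h]
          · rw [max_eq_left h]
            exact ENNReal.ofReal_le_ofReal (hv n)
      _ = ∫⁻ ω, ENNReal.ofReal ((keyCountAt X N t ω - c) ^ 2) ∂P :=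
          (lintegral_arrivals hmodel t
            (fun n x => ENNReal.ofReal (((keyCount x n : ℝ) - c) ^ 2)) fun n =>
            (Measurable.of_discrete (f := fun m : ℕ => ENNReal.ofReal (((m : ℝ) - c) ^ 2))).comp
              (measurable_keyCount n)).symm
      _ = ENNReal.ofReal Var[keyCountAt X N t; P] := by
          rw [ofReal_variance hK, evariance_eq_lintegral_ofReal]
  rw [ENNReal.ofReal_le_ofReal_iff (variance_nonneg _ _),
    integral_sub (hint.const_mul a) (integrable_const C), integral_const_mul] at h1
  simp only [integral_const, probReal_univ, one_smul] at h1
  have h2 := mul_le_mul_of_nonneg_left (sq_le_integral_sq_poissonMeasure t) ha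
  linarith

theorem eventually_le_variance_keyCountAt (hmodel : IsPoissonKeyModel μ X N P)
    (hsum : Summable fun k : ℕ => √(coincidence μ k)) {ε : ℝ} (hε : 0 < ε) :
    ∀ᶠ t : ℝ≥0 in atTop, 7 - 2 * Real.pi ^ 2 / 3 - ε ≤
      ((t : ℝ) ^ 2)⁻¹ * Var[keyCountAt X N t; P] := by
  -- The previous bound needs a nonnegative coefficient; otherwise the claim is trivial. Half of `ε`
  -- is kept to absorb `C / t²`.
  rcases le_or_gt (7 - 2 * Real.pi ^ 2 / 3 - ε / 2) 0 with ha | ha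
  · refine Eventually.of_forall fun t => le_trans (b := 0) (by linarith) ?_
    exact mul_nonneg (by positivity) (variance_nonneg _ _)
  · obtain ⟨C, hC⟩ := exists_varKey_ge (half_pos hε)
    have hlim : Tendsto (fun t : ℝ≥0 => C * ((t : ℝ) ^ 2)⁻¹) atTop (𝓝 (C * 0)) :=
      (((tendsto_pow_atTop two_ne_zero).comp
        (NNReal.tendsto_coe_atTop.2 tendsto_id)).inv_tendsto_atTop).const_mul C
    rw [mul_zero] at hlim
    filter_upwards [hlim.eventually_lt_const (half_pos hε), eventually_gt_atTop 0] with t ht ht0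
    have h := le_variance_keyCountAt hmodel hsum ha.le hC t
    have ht0' : (0 : ℝ) < t := ht0
    have h2 := mul_le_mul_of_nonneg_left h (inv_nonneg.2 (sq_nonneg (t : ℝ)))
    have e : ((t : ℝ) ^ 2)⁻¹ * ((7 - 2 * Real.pi ^ 2 / 3 - ε / 2) * (t : ℝ) ^ 2 - C) =
        (7 - 2 * Real.pi ^ 2 / 3 - ε / 2) - C * ((t : ℝ) ^ 2)⁻¹ := by
      field_simp
    rw [e] at h2
    linarith

end Model

end QuickSortSymbols

/-! ### The proposition -/

open QuickSortSymbols
theorem proposition2p3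
    {α : Type*} [Fintype α] [LinearOrder α] [MeasurableSpace α] [MeasurableSingletonClass α]
    {Ω : Type*} [MeasurableSpace Ω] (P : Measure Ω) [IsProbabilityMeasure P]
    (μ : Measure (ℕ → α)) [IsProbabilityMeasure μ]
    (X : ℕ → Ω → ℕ → α) (N : ℝ≥0 → Ω → ℕ) (hmodel : IsPoissonKeyModel μ X N P)
    (hsum : Summable (fun k : ℕ => Real.sqrt (∑ w : Fin k → α, prefixProb μ w ^ 2)))
    (hcorr : ∀ t : ℝ≥0, 0 < t → ∀ (j k : ℕ) (v : Fin j → α) (w : Fin k → α),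
      0 ≤ cov[prefixCountAt X N v t, prefixCountAt X N w t; P]) :
    (∀ t : ℝ≥0, 0 < t →
      (∀ᵐ ω ∂P, symbolCountAt X N t ω ≠ ⊤) ∧
      MemLp (realSymbolCountAt X N t) 2 P ∧
      MemLp (keyCountAt X N t) 2 P ∧
      Var[scaledLevelCount X N P 0 t; P] ≤ Var[scaledSymbolCount X N P t; P] ∧
      Var[scaledLevelCount X N P 0 t; P] = ((t : ℝ) ^ 2)⁻¹ * Var[keyCountAt X N t; P]) ∧
    0 < 7 - 2 * Real.pi ^ 2 / 3 ∧
    (∀ ε : ℝ, 0 < ε → ∀ᶠ t : ℝ≥0 in atTop,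
      7 - 2 * Real.pi ^ 2 / 3 - ε ≤ Var[scaledSymbolCount X N P t; P]) ∧
    (∀ Y : Ω → ℝ, AEStronglyMeasurable Y P →
      Tendsto (fun t : ℝ≥0 => eLpNorm (fun ω => scaledSymbolCount X N P t ω - Y ω) 2 P)
        atTop (𝓝 0) →
      MemLp Y 2 P ∧ 7 - 2 * Real.pi ^ 2 / 3 ≤ Var[Y; P] ∧ ¬ ∃ c : ℝ, Y =ᵐ[P] fun _ => c) := by
  have hsum' : Summable fun k : ℕ => √(coincidence μ k) := hsum
  have hS := memLp_realSymbolCountAt hmodel hsum'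
  have hK : ∀ t, MemLp (keyCountAt X N t) 2 P := fun t => by
    rw [← levelCountAt_zero]
    exact memLp_levelCountAt hmodel 0 t
  have hvarS : ∀ t, Var[scaledSymbolCount X N P t; P] =
      ((t : ℝ) ^ 2)⁻¹ * Var[realSymbolCountAt X N t; P] := fun t =>
    variance_sub_const_div (hS t).1 _ _
  have hvarK : ∀ t, Var[scaledLevelCount X N P 0 t; P] =
      ((t : ℝ) ^ 2)⁻¹ * Var[keyCountAt X N t; P] := fun t => by
    rw [← levelCountAt_zero]
    exact variance_sub_const_div (memLp_levelCountAt hmodel 0 t).1 _ _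
  have hle : ∀ t : ℝ≥0, 0 < t →
      Var[scaledLevelCount X N P 0 t; P] ≤ Var[scaledSymbolCount X N P t; P] := by
    intro t ht
    rw [hvarS, hvarK, ← levelCountAt_zero]
    gcongr
    exact variance_levelCountAt_zero_le hmodel hsum' (hcorr t ht)
  have hlow : ∀ ε : ℝ, 0 < ε → ∀ᶠ t : ℝ≥0 in atTop,
      7 - 2 * Real.pi ^ 2 / 3 - ε ≤ Var[scaledSymbolCount X N P t; P] := by
    intro ε hε
    filter_upwards [eventually_le_variance_keyCountAt hmodel hsum' hε, eventually_gt_atTop 0]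
      with t ht ht0
    exact (ht.trans_eq (hvarK t).symm).trans (hle t ht0)
  refine ⟨fun t ht => ⟨ae_symbolCountAt_ne_top hmodel hsum' t, hS t, hK t, hle t ht, hvarK t⟩,
    sigma_sq_pos, hlow, fun Y hY hlim => ?_⟩
  have hscaled : ∀ t, MemLp (scaledSymbolCount X N P t) 2 P := fun t => by
    have h := ((hS t).sub (memLp_const (∫ ω, realSymbolCountAt X N t ω ∂P))).mul_const (t : ℝ)⁻¹
    simp only [Pi.sub_apply, ← div_eq_mul_inv] at h
    exact h
  obtain ⟨hYm, hYv⟩ := le_variance_of_tendsto_eLpNorm (Eventually.of_forall hscaled) hY hlim hlow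
  refine ⟨hYm, hYv, ?_⟩
  rintro ⟨c, hc⟩
  have h0 : Var[Y; P] = 0 := by
    rw [variance_congr hc]
    simp [variance_eq_integral]
  linarith [sigma_sq_pos]
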